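/- The $n$-dimensional augmented cube $AQ_n$ is the graph with vertex set $\{0,1\}^n$ defined recursively as follows: $AQ_1 = K_2$; for $n \ge 2$, $AQ_n$ consists of two copies of $AQ_{n-1}$, on the strings beginning with $0$ and on the strings beginning with $1$ respectively, together with all edges joining $0x_1\cdots x_{n-1}$ to $1y_1\cdots y_{n-1}$ where either $x_i = y_i$ for all $i$, or $x_i \ne y_i$ for all $i$. Let $G$ be a finite simple graph and $S \subseteq V(G)$ with $|S| \ge 2$. A pendant $S$-Steiner tree is a subgraph $T$ of $G$ that is a tree, contains all vertices of $S$, and in which every vertex of $S$ has degree one. Two such distinct trees $T, T'$ are internally disjoint if $E(T)\cap E(T') = \emptyset$ and $V(T)\cap V(T') = S$. Let $\tau_G(S)$ be the maximum number of pairwise internally disjoint pendant $S$-Steiner trees in $G$, and, for $2 \le k \le |V(G)|$, let $$\tau_k(G) = \min\{\tau_G(S) : S \subseteq V(G),\ |S| = k\}.$$ **Theorem.** For every integer $n \ge 3$, the pendant $3$-tree-connectivity of the augmented cube is $\tau_3(AQ_n) = 2n-3$. -/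

import Mathlib

/-- The `n`-dimensional augmented cube, a graph on the binary strings of length `n`; the first
letter of a string is its value at `0`. In dimension one it is the complete graph on two vertices.
For `n ≥ 2` it consists of two copies of the cube of dimension `n - 1` (strings that start with the
same letter), and two strings that start with different letters are adjacent exactly when their
tails are equal (hypercube edge) or complementary (complementary edge). Dimension zero is a
single vertex. -/
def augmentedCube : (n : ℕ) → SimpleGraph (Fin n → Bool)
  | 0 => ⊥
  | 1 => ⊤
  | n + 2 =>
    { Adj := fun x y =>
        (x 0 = y 0 ∧ (augmentedCube (n + 1)).Adj (Fin.tail x) (Fin.tail y)) ∨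
        (x 0 ≠ y 0 ∧ (Fin.tail x = Fin.tail y ∨ ∀ i, Fin.tail x i = !(Fin.tail y i)))
      symm := ⟨by
        rintro x y (⟨h, h'⟩ | ⟨h, h' | h'⟩)
        · exact Or.inl ⟨h.symm, h'.symm⟩
        · exact Or.inr ⟨h.symm, Or.inl h'.symm⟩
        · exact Or.inr ⟨h.symm, Or.inr fun i => by simp [h' i]⟩⟩
      loopless := ⟨by
        rintro x (⟨-, h⟩ | ⟨h, -⟩)
        · exact h.ne rfl
        · exact h rfl⟩ }

namespace SimpleGraph

variable {V : Type*} {G : SimpleGraph V}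

/-- `T` is an `S`-Steiner tree of `G`: a subgraph that is a tree and contains all vertices
of `S`. -/
def IsSteinerTree (S : Finset V) (T : G.Subgraph) : Prop :=
  T.coe.IsTree ∧ (S : Set V) ⊆ T.verts

/-- `T` is a pendant `S`-Steiner tree: each vertex of `S` has degree one in `T`. -/
def IsPendantSteinerTree (S : Finset V) (T : G.Subgraph) : Prop :=
  IsSteinerTree S T ∧ ∀ v ∈ S, (T.neighborSet v).encard = 1

/-- Two `S`-Steiner trees are internally disjoint if they share no edge, and no vertex
outside `S`. -/
def InternallyDisjoint (S : Finset V) (T T' : G.Subgraph) : Prop :=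
  T.edgeSet ∩ T'.edgeSet = ∅ ∧ T.verts ∩ T'.verts = (S : Set V)

/-- `F` is a set of pairwise internally disjoint pendant `S`-Steiner trees of `G`. -/
def IsPendantSteinerFamily (S : Finset V) (F : Set G.Subgraph) : Prop :=
  (∀ T ∈ F, IsPendantSteinerTree S T) ∧ F.Pairwise (InternallyDisjoint S)

/-- The local pendant tree-connectivity `τ_G(S)`: the largest number of pairwise internally
disjoint pendant `S`-Steiner trees in `G`. -/
noncomputable def localPendantTreeConnectivity (G : SimpleGraph V) (S : Finset V) : ℕ∞ :=
  ⨆ (F : Set G.Subgraph) (_ : IsPendantSteinerFamily S F), F.encard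

/-- The pendant `k`-tree-connectivity `τ_k(G)`: the least value of `τ_G(S)` over all sets `S` of
`k` vertices. -/
noncomputable def pendantTreeConnectivity (G : SimpleGraph V) (k : ℕ) : ℕ∞ :=
  ⨅ (S : Finset V) (_ : S.card = k), G.localPendantTreeConnectivity S

end SimpleGraph

/-! ### Connection sets of vector sequences over the field with two elements, and their symmetries.
-/

namespace AugmentedCube

variable {V : Type*} [AddCommGroup V]

/-! The augmented cube is a Cayley graph of $\mathbb F_2^n$: for a suitable basis $d_1,\dots,d_n$
the connection set consists of the $d_i$ and the sums $d_i+d_{i+1}$, which are $2n-1$ vectors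
(`adj_iff`, `Indep.ncard_gens`). This set does not change when the sequence is reversed or when
$d_1$ is replaced by $d_1+d_2$. Hence there are two ways to split the cube into halves, by dropping
the first or the last vector, and the two halves of the first split can be matched along $d_1$ or
along $d_1+d_2$.

Upper bound: the pendant trees use different edges at a vertex $x \in S$, and these edges leave $S$
when $|S| \ge 3$. In the triangle $0, d_1, d_1+d_2$ two of the $2n-1$ neighbors of $0$ are lost to
$S$.

Lower bound: a connected set off $S$ with a neighbor of each element of $S$ yields a pendant tree,
so $2n-3$ disjoint such sets suffice (`Indep.packs`, by induction). If $S$ lies in one half of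
either split, the opposite half, cut in two, supplies two further sets (`Packs.cons`). Otherwise the
first split puts $a, b$ in one half and $c$ in the other; let $w$ be the partner of $c$. The half of
$a$ has degree $2n-3$, and contains that many disjoint connections from $a$ to $b$, and equally many
from $a$ to $w$. Shift the latter to the half of $c$ and glue connections that leave $a$ in the same
direction (`Linked.packs`). This needs $w \ne a, b$. If both matchings violate it, then
$\{a,b\}=\{c+d_1,c+d_1+d_2\}$, and $S$ lies in one half of the last split after all.

The connections come from `Indep.linked`, an induction of the same type with steps `Linked.cons` and
`Linked.cross`. Small dimensions are settled by explicit tables. -/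

/-- The connection set attached to a sequence of vectors: its members and the sums of two
consecutive members. -/
def gens (l : List V) : Set V := {x | x ∈ l ∨ ∃ a b, [a, b] <:+: l ∧ x = a + b}

theorem gens_reverse (l : List V) : gens l.reverse = gens l := by
  ext x
  simp only [gens, Set.mem_ofPred_eq, List.mem_reverse]
  constructor
  · rintro (h | ⟨a, b, h, rfl⟩)
    · exact Or.inl h
    · refine Or.inr ⟨b, a, ?_, add_comm _ _⟩
      rw [← List.reverse_infix]
      simpa using h
  · rintro (h | ⟨a, b, h, rfl⟩)
    · exact Or.inl h
    · refine Or.inr ⟨b, a, ?_, add_comm _ _⟩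
      rw [← List.reverse_infix]
      simpa using h

theorem gens_nil : gens ([] : List V) = ∅ := by
  ext x; simp [gens]

theorem gens_singleton (d : V) : gens [d] = {d} := by
  ext x
  simp only [gens, List.infix_cons_iff, List.cons_prefix_cons]
  simp

theorem mem_gens_cons_cons {d e x : V} {l : List V} :
    x ∈ gens (d :: e :: l) ↔ x = d ∨ x = d + e ∨ x ∈ gens (e :: l) := by
  simp only [gens, Set.mem_ofPred_eq, List.mem_cons (a := x) (b := d), or_assoc]
  refine or_congr_right ?_
  constructor
  · rintro (h | ⟨a, b, h, rfl⟩)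
    · exact Or.inr (Or.inl h)
    · rw [List.infix_cons_iff] at h
      rcases h with h | h
      · simp only [List.cons_prefix_cons, List.nil_prefix, and_true] at h
        obtain ⟨rfl, rfl⟩ := h
        exact Or.inl rfl
      · exact Or.inr (Or.inr ⟨a, b, h, rfl⟩)
  · rintro (rfl | h | ⟨a, b, h, rfl⟩)
    · exact Or.inr ⟨d, e, by simp [List.infix_cons_iff], rfl⟩
    · exact Or.inl h
    · exact Or.inr ⟨a, b, List.infix_cons_iff.2 (Or.inr h), rfl⟩

theorem gens_subset_cons (d : V) (l : List V) : gens l ⊆ gens (d :: l) := by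
  cases l with
  | nil => simp [gens_nil]
  | cons e l => exact fun x hx => mem_gens_cons_cons.2 (Or.inr (Or.inr hx))

theorem head_mem_gens (d : V) (l : List V) : d ∈ gens (d :: l) := Or.inl (by simp)

theorem gens_finite (l : List V) : (gens l).Finite := by
  induction l with
  | nil => simp [gens_nil]
  | cons d l ih =>
    cases l with
    | nil => simp [gens_singleton]
    | cons e l =>
      refine (ih.insert (d + e)).insert d |>.subset ?_
      intro x hx
      simpa [mem_gens_cons_cons] using hx

variable [Module (ZMod 2) V]

/-- The linear span of a sequence of vectors over the field with two elements. -/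
def sp (l : List V) : Submodule (ZMod 2) V := Submodule.span (ZMod 2) {x | x ∈ l}

/-- A sequence of vectors is independent if the dimension of its span is its length. -/
def Indep (l : List V) : Prop := Module.finrank (ZMod 2) (sp l) = l.length

theorem add_self_left (x y : V) : x + (x + y) = y := by
  rw [← add_assoc, ZModModule.add_self, zero_add]

theorem add_eq_zero_iff (x y : V) : x + y = 0 ↔ x = y := by
  rw [← ZModModule.sub_eq_add, sub_eq_zero]

/-- Since $(d+e)+e=d$, the vectors $d$ and $d+e$ merely trade places. This is the freedom to match
the two halves along either of them. -/
theorem gens_transvection (d e : V) (l : List V) :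
    gens ((d + e) :: e :: l) = gens (d :: e :: l) := by
  ext x
  rw [mem_gens_cons_cons, mem_gens_cons_cons, add_assoc, ZModModule.add_self, add_zero]
  tauto

theorem mem_sp_cons {d x : V} {l : List V} : x ∈ sp (d :: l) ↔ x ∈ sp l ∨ x + d ∈ sp l := by
  have h : {x | x ∈ d :: l} = insert d {x | x ∈ l} := by ext; simp
  rw [sp, h, Submodule.mem_span_insert]
  constructor
  · rintro ⟨a, z, hz, rfl⟩
    obtain rfl | rfl : a = 0 ∨ a = 1 := by revert a; decide
    · rw [zero_smul, zero_add]
      exact Or.inl hz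
    · right
      rw [one_smul, add_comm, add_self_left]
      exact hz
  · rintro (hx | hx)
    · exact ⟨0, x, hx, by simp⟩
    · exact ⟨1, x + d, hx, by rw [one_smul, add_comm x d, add_self_left]⟩

theorem sp_nil : sp ([] : List V) = ⊥ := by simp [sp]

theorem sp_reverse (l : List V) : sp l.reverse = sp l := by simp [sp]

theorem sp_le_cons (d : V) (l : List V) : sp l ≤ sp (d :: l) :=
  fun _ hx => mem_sp_cons.2 (Or.inl hx)

theorem mem_sp_of_mem {x : V} {l : List V} (h : x ∈ l) : x ∈ sp l := Submodule.subset_span h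

theorem gens_subset_sp (l : List V) : gens l ⊆ sp l := by
  rintro x (h | ⟨a, b, h, rfl⟩)
  · exact mem_sp_of_mem h
  · exact add_mem (mem_sp_of_mem (h.subset (by simp))) (mem_sp_of_mem (h.subset (by simp)))

theorem sp_transvection (d e : V) (l : List V) : sp ((d + e) :: e :: l) = sp (d :: e :: l) := by
  have he : e ∈ sp (e :: l) := mem_sp_of_mem (by simp)
  ext x
  rw [mem_sp_cons, mem_sp_cons (d := d), ← add_assoc, Submodule.add_mem_iff_left _ he]

instance (l : List V) : Module.Finite (ZMod 2) (sp l) :=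
  Module.Finite.span_of_finite _ l.finite_toSet

theorem finrank_sp_le (l : List V) : Module.finrank (ZMod 2) (sp l) ≤ l.length := by
  classical
  have h : {x | x ∈ l} = (l.toFinset : Set V) := by ext; simp
  rw [sp, h]
  exact (finrank_span_finset_le_card _).trans (List.toFinset_card_le l)

theorem Indep.tail {d : V} {l : List V} (h : Indep (d :: l)) : Indep l := by
  refine le_antisymm (finrank_sp_le l) ?_
  have h1 : sp (d :: l) ≤ Submodule.span (ZMod 2) {d} ⊔ sp l := by
    rw [sp, Submodule.span_le]
    intro x hx
    rcases List.mem_cons.1 hx with rfl | hx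
    · exact Submodule.mem_sup_left (Submodule.mem_span_singleton_self _)
    · exact Submodule.mem_sup_right (mem_sp_of_mem hx)
  have h2 := (Submodule.finrank_mono h1).trans
    (Submodule.finrank_add_le_finrank_add_finrank _ _)
  have h3 : Module.finrank (ZMod 2) (Submodule.span (ZMod 2) {d}) ≤ 1 := by
    simpa using finrank_span_le_card (R := ZMod 2) ({d} : Set V)
  rw [Indep, List.length_cons] at h
  omega

theorem Indep.head_notMem {d : V} {l : List V} (h : Indep (d :: l)) : d ∉ sp l := by
  intro hd
  have h1 : sp (d :: l) ≤ sp l := by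
    rw [sp, Submodule.span_le]
    intro x hx
    rcases List.mem_cons.1 hx with rfl | hx
    · exact hd
    · exact mem_sp_of_mem hx
  have h2 := (Submodule.finrank_mono h1).trans (finrank_sp_le l)
  rw [Indep, List.length_cons] at h
  omega

theorem Indep.reverse {l : List V} (h : Indep l) : Indep l.reverse := by
  rw [Indep, sp_reverse, List.length_reverse]; exact h

theorem Indep.transvection {d e : V} {l : List V} (h : Indep (d :: e :: l)) :
    Indep ((d + e) :: e :: l) := by
  rw [Indep, sp_transvection]; exact h

theorem Indep.zero_notMem_gens {l : List V} (h : Indep l) : (0 : V) ∉ gens l := by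
  induction l with
  | nil => simp [gens_nil]
  | cons d l ih =>
    have hd := h.head_notMem
    cases l with
    | nil =>
      rw [gens_singleton]
      rintro rfl
      exact hd (zero_mem _)
    | cons e l =>
      rw [mem_gens_cons_cons]
      rintro (rfl | h0 | h0)
      · exact hd (zero_mem _)
      · obtain rfl := (add_eq_zero_iff _ _).1 h0.symm
        exact hd (mem_sp_of_mem (by simp))
      · exact ih h.tail h0

theorem Indep.head_ne_zero {d : V} {l : List V} (h : Indep (d :: l)) : d ≠ 0 := by
  rintro rfl
  exact h.head_notMem (zero_mem _)

/-- A new head `d` in front of `e` contributes `d` and `d + e`, both outside the span of the tail;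
only the last vector contributes a single element. -/
theorem Indep.ncard_gens {l : List V} (h : Indep l) : (gens l).ncard = 2 * l.length - 1 := by
  induction l with
  | nil => simp [gens_nil]
  | cons d l ih =>
    cases l with
    | nil => simp [gens_singleton]
    | cons e l =>
      have hd := h.head_notMem
      have he : e ∈ sp (e :: l) := mem_sp_of_mem (by simp)
      have h1 : gens (d :: e :: l) = insert d (insert (d + e) (gens (e :: l))) := by
        ext x; simp [mem_gens_cons_cons]
      have h2 : d + e ∉ gens (e :: l) := fun hx =>
        hd ((Submodule.add_mem_iff_left _ he).1 (gens_subset_sp _ hx))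
      have h3 : d ∉ insert (d + e) (gens (e :: l)) := by
        rintro (hx | hx)
        · exact h.tail.head_ne_zero (by simpa using hx)
        · exact hd (gens_subset_sp _ hx)
      rw [h1, Set.ncard_insert_of_notMem h3 ((gens_finite _).insert _),
        Set.ncard_insert_of_notMem h2 (gens_finite _), ih h.tail]
      simp only [List.length_cons]
      omega

end AugmentedCube

/-! ### Connected sets in the Cayley graph. -/

namespace AugmentedCube

open Relation

variable {V : Type*} [AddCommGroup V]

/-- One step inside `A` along a vector of the connection set of `l`. -/
def Step (l : List V) (A : Set V) (a b : V) : Prop := a ∈ A ∧ b ∈ A ∧ a + b ∈ gens l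

/-- The set `A` is nonempty and connected in the Cayley graph of the connection set of `l`. -/
def Conn (l : List V) (A : Set V) : Prop :=
  A.Nonempty ∧ ∀ x ∈ A, ∀ y ∈ A, ReflTransGen (Step l A) x y

theorem Step.symm {l : List V} {A : Set V} {a b : V} (h : Step l A a b) : Step l A b a :=
  ⟨h.2.1, h.1, add_comm a b ▸ h.2.2⟩

theorem step_path_symm {l : List V} {A : Set V} {a b : V} (h : ReflTransGen (Step l A) a b) :
    ReflTransGen (Step l A) b a := by
  induction h with
  | refl => exact ReflTransGen.refl
  | tail _ h ih => exact ReflTransGen.head h.symm ih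

theorem Step.mono {l l' : List V} (hl : gens l ⊆ gens l') {A B : Set V} (hA : A ⊆ B) {a b : V}
    (h : Step l A a b) : Step l' B a b :=
  ⟨hA h.1, hA h.2.1, hl h.2.2⟩

theorem step_path_mono {l l' : List V} (hl : gens l ⊆ gens l') {A B : Set V} (hA : A ⊆ B)
    {a b : V} (h : ReflTransGen (Step l A) a b) : ReflTransGen (Step l' B) a b := by
  induction h with
  | refl => exact ReflTransGen.refl
  | tail _ h ih => exact ih.tail (h.mono hl hA)

theorem Conn.mono {l l' : List V} (hl : gens l ⊆ gens l') {A : Set V} (h : Conn l A) :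
    Conn l' A :=
  ⟨h.1, fun x hx y hy => step_path_mono hl subset_rfl (h.2 x hx y hy)⟩

theorem conn_singleton (l : List V) (x : V) : Conn l {x} := by
  refine ⟨⟨x, rfl⟩, ?_⟩
  rintro _ rfl _ rfl
  exact ReflTransGen.refl

/-- A set is connected if it contains a connected subset to which each of its elements is
adjacent. -/
theorem Conn.extend {l : List V} {A B : Set V} (h : Conn l A) (hAB : A ⊆ B)
    (hB : ∀ s ∈ B, s ∉ A → ∃ a ∈ A, s + a ∈ gens l) : Conn l B := by
  obtain ⟨c, hc⟩ := h.1
  have key : ∀ s ∈ B, ReflTransGen (Step l B) s c := by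
    intro s hs
    by_cases hA : s ∈ A
    · exact step_path_mono subset_rfl hAB (h.2 s hA c hc)
    · obtain ⟨a, ha, hsa⟩ := hB s hs hA
      exact ReflTransGen.head ⟨hs, hAB ha, hsa⟩
        (step_path_mono subset_rfl hAB (h.2 a ha c hc))
  exact ⟨h.1.mono hAB, fun x hx y hy => (key x hx).trans (step_path_symm (key y hy))⟩

theorem Conn.insert {l : List V} {A : Set V} (h : Conn l A) {a x : V} (ha : a ∈ A)
    (hx : x + a ∈ gens l) : Conn l (insert x A) :=
  h.extend (Set.subset_insert _ _) fun s hs hsA => by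
    obtain rfl | hs := hs
    · exact ⟨a, ha, hx⟩
    · exact absurd hs hsA

theorem Conn.union {l : List V} {A B : Set V} (hA : Conn l A) (hB : Conn l B) {a b : V}
    (ha : a ∈ A) (hb : b ∈ B) (hab : a + b ∈ gens l) : Conn l (A ∪ B) := by
  have key : ∀ s ∈ A ∪ B, ReflTransGen (Step l (A ∪ B)) s a := by
    rintro s (hs | hs)
    · exact step_path_mono subset_rfl Set.subset_union_left (hA.2 s hs a ha)
    · exact (step_path_mono subset_rfl Set.subset_union_right (hB.2 s hs b hb)).tail
        ⟨Or.inr hb, Or.inl ha, add_comm a b ▸ hab⟩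
  exact ⟨hA.1.inl, fun x hx y hy => (key x hx).trans (step_path_symm (key y hy))⟩

/-- Walking from `w` to `u` inside a connected set, the part up to the first neighbor of `u` is
a connected set that contains exactly one neighbor of `u`. -/
theorem Conn.exists_subset_unique_neighbor {l : List V} {A : Set V} (h : Conn l A) {u w : V}
    (hu : u ∈ A) (hw : w ∈ A) (huw : w ≠ u) :
    ∃ P ⊆ A, Conn l P ∧ w ∈ P ∧ u ∉ P ∧ ∃ p ∈ P, u + p ∈ gens l ∧
      ∀ q ∈ P, u + q ∈ gens l → q = p := by
  induction h.2 w hw u hu using ReflTransGen.head_induction_on with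
  | refl => exact absurd rfl huw
  | @head a c hac _ ih =>
    by_cases ha : u + a ∈ gens l
    · refine ⟨{a}, by simpa using hw, conn_singleton l a, rfl, huw.symm, a, rfl, ha, ?_⟩
      rintro q rfl -
      rfl
    · have hcu : c ≠ u := by
        rintro rfl
        exact ha (add_comm a c ▸ hac.2.2)
      obtain ⟨P, hPA, hP, hcP, huP, p, hp, hup, hq⟩ := ih hac.2.1 hcu
      refine ⟨Insert.insert a P, Set.insert_subset hw hPA, hP.insert hcP hac.2.2,
        Set.mem_insert _ _, ?_, p, Or.inr hp, hup, ?_⟩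
      · rintro (h | h)
        · exact huw h.symm
        · exact huP h
      · rintro q (rfl | hqP) hqu
        · exact absurd hqu ha
        · exact hq q hqP hqu

variable [Module (ZMod 2) V]

theorem add_cancel_right (x y : V) : x + y + y = x := by
  rw [add_assoc, ZModModule.add_self, add_zero]

theorem add_add_add_cancel (x y d : V) : x + d + (y + d) = x + y := by
  rw [add_add_add_comm, ZModModule.add_self, add_zero]

theorem Conn.translate {l : List V} {A : Set V} (h : Conn l A) (d : V) :
    Conn l {t | t + d ∈ A} := by
  obtain ⟨⟨a, ha⟩, h2⟩ := h
  have key : ∀ x y, Step l A x y → Step l {t | t + d ∈ A} (x + d) (y + d) := by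
    rintro x y ⟨hx, hy, hxy⟩
    refine ⟨?_, ?_, ?_⟩
    · rwa [Set.mem_ofPred_eq, add_cancel_right]
    · rwa [Set.mem_ofPred_eq, add_cancel_right]
    · rwa [add_add_add_cancel]
  refine ⟨⟨a + d, by rwa [Set.mem_ofPred_eq, add_cancel_right]⟩, fun x hx y hy => ?_⟩
  have : ReflTransGen (Step l {t | t + d ∈ A}) (x + d + d) (y + d + d) :=
    ReflTransGen.lift (· + d) key _ _ (h2 _ hx _ hy)
  rwa [add_cancel_right, add_cancel_right] at this

/-- A coset of the larger span is a union of two cosets of the smaller one, joined by the edge from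
`u` to `u + d`. -/
theorem conn_coset (l : List V) (u : V) : Conn l {t | t + u ∈ sp l} := by
  induction l generalizing u with
  | nil =>
    have : {t | t + u ∈ sp ([] : List V)} = {u} := by
      ext t
      simp [sp_nil, add_eq_zero_iff]
    rw [this]
    exact conn_singleton _ _
  | cons d l ih =>
    have h : {t | t + u ∈ sp (d :: l)} = {t | t + u ∈ sp l} ∪ {t | t + (u + d) ∈ sp l} := by
      ext t
      simp only [Set.mem_union, Set.mem_ofPred_eq, mem_sp_cons, add_assoc]
    rw [h]
    refine ((ih u).mono (gens_subset_cons d l)).union ((ih (u + d)).mono (gens_subset_cons d l))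
      (a := u) (b := u + d) ?_ ?_ ?_
    · rw [Set.mem_ofPred_eq, ZModModule.add_self]
      exact zero_mem _
    · rw [Set.mem_ofPred_eq, ZModModule.add_self]
      exact zero_mem _
    · rw [add_self_left]
      exact head_mem_gens d l

/-- The half without `c` is intact and connected, and every remaining vertex of the other half hangs
on it by its edge along `d`. -/
theorem Indep.conn_coset_diff_singleton {d : V} {l : List V} (h : Indep (d :: l)) (c : V) :
    Conn (d :: l) ({t | t + c ∈ sp (d :: l)} \ {c}) := by
  refine ((conn_coset l (c + d)).mono (gens_subset_cons d l)).extend ?_ ?_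
  · intro t ht
    rw [Set.mem_ofPred_eq, ← add_assoc] at ht
    refine ⟨mem_sp_cons.2 (Or.inr ht), ?_⟩
    rintro rfl
    rw [ZModModule.add_self, zero_add] at ht
    exact h.head_notMem ht
  · rintro s ⟨hs, -⟩ hs'
    refine ⟨s + d, ?_, ?_⟩
    · rw [Set.mem_ofPred_eq, add_add_add_cancel]
      refine (mem_sp_cons.1 hs).resolve_right fun h => hs' ?_
      rwa [add_assoc] at h
    · rw [add_self_left]
      exact head_mem_gens d l

end AugmentedCube

/-! ### Packings and linkings, and their extension by one dimension. -/

namespace AugmentedCube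

variable {V : Type*} [AddCommGroup V]

theorem conn_congr {l l' : List V} (hg : gens l = gens l') {A : Set V} : Conn l A ↔ Conn l' A :=
  ⟨Conn.mono hg.subset, Conn.mono hg.symm.subset⟩

variable [Module (ZMod 2) V]

/-- The sets `C i` are connected, pairwise disjoint, avoid `S`, and each of them contains a
neighbor of each element of `S`; everything takes place in one coset of the span of `l`. -/
def IsPacking (l : List V) (S : Set V) {ι : Type*} (C : ι → Set V) : Prop :=
  (∀ i, Conn l (C i) ∧ (∀ t ∈ C i, t ∉ S ∧ ∀ s ∈ S, t + s ∈ sp l) ∧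
    ∀ s ∈ S, ∃ t ∈ C i, s + t ∈ gens l) ∧
  ∀ i j, ∀ t ∈ C i, t ∈ C j → i = j

/-- There is a packing by `N` sets. -/
def Packs (l : List V) (S : Set V) (N : ℕ) : Prop := ∃ C : Fin N → Set V, IsPacking l S C

/-- The sets `E g` are connected, pairwise disjoint, avoid `u` and `v`, and `E g` joins the
neighbor `u + g` of `u` to a neighbor of `v`; if `v` is adjacent to `u`, the set that belongs to
the edge is empty. -/
def IsLinking (l : List V) (u v : V) (E : V → Set V) : Prop :=
  (∀ g ∈ gens l, u + g ≠ v → Conn l (E g) ∧ u + g ∈ E g ∧ ∃ t ∈ E g, v + t ∈ gens l) ∧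
  (∀ g ∈ gens l, u + g = v → E g = ∅) ∧
  (∀ g ∈ gens l, ∀ t ∈ E g, t + u ∈ sp l ∧ t ≠ u ∧ t ≠ v) ∧
  ∀ g ∈ gens l, ∀ g' ∈ gens l, ∀ t ∈ E g, t ∈ E g' → g = g'

/-- There are as many internally disjoint connections from `u` to `v` as `u` has neighbors. -/
def Linked (l : List V) (u v : V) : Prop := ∃ E, IsLinking l u v E

theorem packs_congr {l l' : List V} (hg : gens l = gens l') (hs : sp l = sp l') {S : Set V}
    {N : ℕ} : Packs l S N ↔ Packs l' S N := by
  simp only [Packs, IsPacking, conn_congr hg, hg, hs]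

theorem linked_congr {l l' : List V} (hg : gens l = gens l') (hs : sp l = sp l') {u v : V} :
    Linked l u v ↔ Linked l' u v := by
  simp only [Linked, IsLinking, conn_congr hg, hg, hs]

theorem IsPacking.packs {l : List V} {S : Set V} {ι : Type*} [Finite ι] {C : ι → Set V}
    (h : IsPacking l S C) : Packs l S (Nat.card ι) := by
  let f := (Finite.equivFin ι).symm
  exact ⟨fun i => C (f i), fun i => h.1 (f i), fun i j t hi hj => f.injective (h.2 _ _ t hi hj)⟩

/-- The second layer of a cube consists of two disjoint connected halves, and each vertex of the
first layer has a neighbor in either half. -/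
theorem Indep.exists_halves {d e : V} {m : List V} (h : Indep (d :: e :: m)) (u : V) :
    ∃ A B : Set V, Conn (d :: e :: m) A ∧ Conn (d :: e :: m) B ∧ (∀ t ∈ A, t ∉ B) ∧
      (∀ t ∈ A ∪ B, t + u ∈ sp (d :: e :: m) ∧ t + u ∉ sp (e :: m)) ∧
      u + d ∈ A ∧ u + (d + e) ∈ B ∧
      ∀ x, x + u ∈ sp (e :: m) →
        (∃ t ∈ A, x + t ∈ gens (d :: e :: m)) ∧ ∃ t ∈ B, x + t ∈ gens (d :: e :: m) := by
  have hd := h.head_notMem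
  have he := h.tail.head_notMem
  have hem : e ∈ sp (e :: m) := mem_sp_of_mem (by simp)
  have hg := (gens_subset_cons e m).trans (gens_subset_cons d (e :: m))
  have hd1 : d ∈ gens (d :: e :: m) := head_mem_gens _ _
  have hd2 : d + e ∈ gens (d :: e :: m) := mem_gens_cons_cons.2 (Or.inr (Or.inl rfl))
  have layer : ∀ t, t + u + d ∈ sp (e :: m) → t + u ∈ sp (d :: e :: m) ∧ t + u ∉ sp (e :: m) := by
    intro t ht
    exact ⟨mem_sp_cons.2 (Or.inr ht), fun h' => hd ((Submodule.add_mem_iff_right _ h').1 ht)⟩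
  -- The second layer is cut along `e`. For `x` in the first layer, `x + d` and `x + (d + e)` differ
  -- by `e`, so one of them lies in each half.
  refine ⟨{t | t + (u + d) ∈ sp m}, {t | t + (u + (d + e)) ∈ sp m}, (conn_coset m _).mono hg,
    (conn_coset m _).mono hg, ?_, ?_, ?_, ?_, ?_⟩
  · intro t ht ht'
    rw [Set.mem_ofPred_eq] at ht ht'
    have h1 := add_mem ht ht'
    have h2 : t + (u + d) + (t + (u + (d + e))) = e := by
      simp only [add_assoc, add_left_comm, add_self_left]
    rw [h2] at h1
    exact he h1
  · rintro t (ht | ht)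
    · refine layer t (sp_le_cons _ _ ?_)
      rwa [Set.mem_ofPred_eq, ← add_assoc] at ht
    · refine layer t ((Submodule.add_mem_iff_left _ hem).1 (sp_le_cons _ _ ?_))
      rwa [Set.mem_ofPred_eq, ← add_assoc, ← add_assoc] at ht
  · rw [Set.mem_ofPred_eq, ZModModule.add_self]
    exact zero_mem _
  · rw [Set.mem_ofPred_eq, ZModModule.add_self]
    exact zero_mem _
  · intro x hx
    rcases mem_sp_cons.1 hx with hx | hx
    · refine ⟨⟨x + d, ?_, ?_⟩, ⟨x + (d + e), ?_, ?_⟩⟩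
      · rwa [Set.mem_ofPred_eq, add_add_add_cancel]
      · rwa [add_self_left]
      · rwa [Set.mem_ofPred_eq, add_add_add_cancel]
      · rwa [add_self_left]
    · refine ⟨⟨x + (d + e), ?_, ?_⟩, ⟨x + d, ?_, ?_⟩⟩
      · have h2 : x + (d + e) + (u + d) = x + u + e := by
          simp only [add_comm, add_left_comm, add_self_left]
        rwa [Set.mem_ofPred_eq, h2]
      · rwa [add_self_left]
      · have h2 : x + d + (u + (d + e)) = x + u + e := by
          simp only [add_comm, add_left_comm, add_self_left]
        rwa [Set.mem_ofPred_eq, h2]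
      · rwa [add_self_left]

/-- The layer opposite to `S` is free, and its two halves are the two additional sets. -/
theorem Packs.cons {d e : V} {m : List V} (h : Indep (d :: e :: m)) {S : Set V} {N : ℕ} {u : V}
    (hS : ∀ s ∈ S, s + u ∈ sp (e :: m)) (hu : u ∈ S) (hP : Packs (e :: m) S N) :
    Packs (d :: e :: m) S (N + 2) := by
  obtain ⟨A, B, hA, hB, hAB, hL, -, -, hx⟩ := h.exists_halves u
  obtain ⟨C, hC, hCd⟩ := hP
  have hsp := sp_le_cons d (e :: m)
  have key : ∀ t ∈ A ∪ B, (t ∉ S ∧ ∀ s ∈ S, t + s ∈ sp (d :: e :: m)) ∧ ∀ i, t ∉ C i := by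
    intro t ht
    obtain ⟨h1, h2⟩ := hL t ht
    refine ⟨⟨fun hts => h2 (hS t hts), fun s hs => ?_⟩, fun i hi => h2 (((hC i).2.1 t hi).2 u hu)⟩
    have := add_mem h1 (hsp (hS s hs))
    rwa [add_add_add_cancel] at this
  have : IsPacking (d :: e :: m) S (fun i : Option (Option (Fin N)) =>
      i.elim A fun j => j.elim B C) := by
    constructor
    · rintro (_ | _ | i)
      · exact ⟨hA, fun t ht => (key t (Or.inl ht)).1, fun s hs => (hx s (hS s hs)).1⟩
      · exact ⟨hB, fun t ht => (key t (Or.inr ht)).1, fun s hs => (hx s (hS s hs)).2⟩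
      · refine ⟨(hC i).1.mono (gens_subset_cons _ _), fun t ht => ⟨((hC i).2.1 t ht).1,
          fun s hs => hsp (((hC i).2.1 t ht).2 s hs)⟩, fun s hs => ?_⟩
        obtain ⟨t, ht, hst⟩ := (hC i).2.2 s hs
        exact ⟨t, ht, gens_subset_cons _ _ hst⟩
    · rintro (_ | _ | i) (_ | _ | j) t hi hj
      · rfl
      · exact absurd hj (hAB t hi)
      · exact absurd hj ((key t (Or.inl hi)).2 j)
      · exact absurd hi (hAB t hj)
      · rfl
      · exact absurd hj ((key t (Or.inr hi)).2 j)
      · exact absurd hi ((key t (Or.inl hj)).2 i)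
      · exact absurd hi ((key t (Or.inr hj)).2 i)
      · rw [hCd i j t hi hj]
  simpa using this.packs

/-- The two new neighbors `u + d` and `u + (d + e)` lie in different halves of the opposite layer,
and each half contains a neighbor of `v`; the halves serve as the two new connections. -/
theorem Linked.cons {d e : V} {m : List V} (h : Indep (d :: e :: m)) {u v : V}
    (huv : v + u ∈ sp (e :: m)) (hL : Linked (e :: m) u v) : Linked (d :: e :: m) u v := by
  classical
  obtain ⟨A, B, hA, hB, hAB, hlay, huA, huB, hx⟩ := h.exists_halves u
  obtain ⟨E, h1, h2, h3, h4⟩ := hL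
  have hd := h.head_notMem
  have hem : e ∈ sp (e :: m) := mem_sp_of_mem (by simp)
  have hgs := gens_subset_sp (e :: m)
  have hde : d + e ∉ sp (e :: m) := fun h => hd ((Submodule.add_mem_iff_left _ hem).1 h)
  have hne : d + e ≠ d := fun h' => h.tail.head_ne_zero (by simpa using h')
  have huu : u + u ∈ sp (e :: m) := by
    rw [ZModModule.add_self]
    exact zero_mem _
  have hnd : ∀ g ∈ gens (e :: m), g ≠ d := by
    rintro _ hg rfl
    exact hd (hgs hg)
  have hnde : ∀ g ∈ gens (e :: m), g ≠ d + e := by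
    rintro _ hg rfl
    exact hde (hgs hg)
  have huA' : ∀ g ∈ gens (e :: m), ∀ t ∈ A ∪ B, t ∉ E g := fun g hg t ht htg =>
    (hlay t ht).2 (h3 g hg t htg).1
  have avoid : ∀ t ∈ A ∪ B, t + u ∈ sp (d :: e :: m) ∧ t ≠ u ∧ t ≠ v := by
    intro t ht
    refine ⟨(hlay t ht).1, ?_, ?_⟩
    · rintro rfl
      exact (hlay t ht).2 huu
    · rintro rfl
      exact (hlay t ht).2 huv
  have notv : ∀ g, g ∉ sp (e :: m) → u + g ≠ v := by
    rintro g hg rfl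
    rw [add_comm, add_self_left] at huv
    exact hg huv
  obtain ⟨E', hE1, hE2, hE3⟩ : ∃ E' : V → Set V, E' d = A ∧ E' (d + e) = B ∧
      ∀ g ∈ gens (e :: m), E' g = E g := by
    refine ⟨fun g => if g = d then A else if g = d + e then B else E g, if_pos rfl, ?_, ?_⟩
    · exact (if_neg hne).trans (if_pos rfl)
    · exact fun g hg => (if_neg (hnd g hg)).trans (if_neg (hnde g hg))
  refine ⟨E', ?_, ?_, ?_, ?_⟩
  · intro g hg hgv
    rcases mem_gens_cons_cons.1 hg with rfl | rfl | hg
    · rw [hE1]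
      exact ⟨hA, huA, (hx v huv).1⟩
    · rw [hE2]
      exact ⟨hB, huB, (hx v huv).2⟩
    · rw [hE3 g hg]
      obtain ⟨hc, hm, t, ht, hvt⟩ := h1 g hg hgv
      exact ⟨hc.mono (gens_subset_cons _ _), hm, t, ht, gens_subset_cons _ _ hvt⟩
  · intro g hg hgv
    rcases mem_gens_cons_cons.1 hg with rfl | rfl | hg
    · exact absurd hgv (notv _ hd)
    · exact absurd hgv (notv _ hde)
    · rw [hE3 g hg]
      exact h2 g hg hgv
  · intro g hg t ht
    rcases mem_gens_cons_cons.1 hg with rfl | rfl | hg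
    · rw [hE1] at ht
      exact avoid t (Or.inl ht)
    · rw [hE2] at ht
      exact avoid t (Or.inr ht)
    · rw [hE3 g hg] at ht
      exact ⟨sp_le_cons _ _ (h3 g hg t ht).1, (h3 g hg t ht).2⟩
  · intro g hg g' hg' t ht ht'
    rcases mem_gens_cons_cons.1 hg with rfl | rfl | hg1 <;>
      rcases mem_gens_cons_cons.1 hg' with rfl | rfl | hg2
    · rfl
    · rw [hE1] at ht
      rw [hE2] at ht'
      exact absurd ht' (hAB t ht)
    · rw [hE1] at ht
      rw [hE3 g' hg2] at ht'
      exact absurd ht' (huA' g' hg2 t (Or.inl ht))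
    · rw [hE1] at ht'
      rw [hE2] at ht
      exact absurd ht (hAB t ht')
    · rfl
    · rw [hE2] at ht
      rw [hE3 g' hg2] at ht'
      exact absurd ht' (huA' g' hg2 t (Or.inr ht))
    · rw [hE1] at ht'
      rw [hE3 g hg1] at ht
      exact absurd ht (huA' g hg1 t (Or.inl ht'))
    · rw [hE2] at ht'
      rw [hE3 g hg1] at ht
      exact absurd ht (huA' g hg1 t (Or.inr ht'))
    · rw [hE3 g hg1] at ht
      rw [hE3 g' hg2] at ht'
      exact h4 g hg1 g' hg2 t ht ht'

end AugmentedCube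

/-! ### Passing from one half of the cube to the other. -/

namespace AugmentedCube

variable {V : Type*} [AddCommGroup V] [Module (ZMod 2) V]

/-- Two linkings of one half of a cube, from `x` to `y` and from `x` to `w`, give a packing for
`x`, `y`, and the neighbor `w + d` of `w` in the other half. -/
theorem Linked.packs {d : V} {l : List V} (h : Indep (d :: l)) {x y w : V}
    (hyx : y + x ∈ sp l) (hwx : w + x ∈ sp l) (hw : w ≠ x) (hwy : w ≠ y)
    (hL : Linked l x y) (hL' : Linked l x w) :
    Packs (d :: l) {x, y, w + d} (gens l).ncard := by
  classical
  obtain ⟨E, hE1, hE2, hE3, hE4⟩ := hL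
  obtain ⟨F, hF1, hF2, hF3, hF4⟩ := hL'
  have hd := h.head_notMem
  have hdg : d ∈ gens (d :: l) := head_mem_gens _ _
  have hgg := gens_subset_cons d l
  have hgs := gens_subset_sp l
  have hFd : ∀ g ∈ gens l, ∀ t, t + d ∈ F g → t + x ∉ sp l := by
    intro g hg t ht h'
    have h1 := add_mem h' (hF3 g hg _ ht).1
    have h2 : t + x + (t + d + x) = d := by
      rw [add_right_comm t d x, add_self_left]
    rw [h2] at h1
    exact hd h1
  -- `E g` and the shifted `F g` are joined by the edge from `x + g` to `x + g + d`. If `x + g = y`,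
  -- then `E g` is empty; the shifted `F g` then reaches `y` through `y + d`, and `x` through the
  -- added vertex `x + d`, which no shifted `F g` contains.
  let C : gens l → Set V := fun g =>
    if x + g.1 = y then insert (x + d) {t | t + d ∈ F g.1} else E g.1 ∪ {t | t + d ∈ F g.1}
  have hC1 : ∀ g : gens l, x + g.1 = y → C g = insert (x + d) {t | t + d ∈ F g.1} :=
    fun g hg => if_pos hg
  have hC2 : ∀ g : gens l, x + g.1 ≠ y → C g = E g.1 ∪ {t | t + d ∈ F g.1} :=
    fun g hg => if_neg hg
  have hxd : x + d + x = d := by rw [add_comm, add_self_left]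
  have hmem : ∀ g : gens l, ∀ t ∈ C g, (t + x ∈ sp l ∧ t ∈ E g.1 ∧ t ≠ x ∧ t ≠ y) ∨
      (t + x ∉ sp l ∧ t + x ∈ sp (d :: l) ∧ t ≠ w + d ∧
        ((t = x + d ∧ x + g.1 = y) ∨ (t + d ∈ F g.1 ∧ t + d ≠ x))) := by
    intro g t ht
    have hF : t + d ∈ F g.1 → t + x ∉ sp l ∧ t + x ∈ sp (d :: l) ∧ t ≠ w + d ∧
        ((t = x + d ∧ x + g.1 = y) ∨ (t + d ∈ F g.1 ∧ t + d ≠ x)) := by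
      intro ht
      obtain ⟨h1, h2, h3⟩ := hF3 _ g.2 _ ht
      refine ⟨hFd _ g.2 t ht, mem_sp_cons.2 (Or.inr ?_), ?_, Or.inr ⟨ht, h2⟩⟩
      · rwa [add_right_comm] at h1
      · rintro rfl
        exact h3 (add_cancel_right _ _)
    by_cases hg : x + g.1 = y
    · rw [hC1 g hg] at ht
      rcases ht with rfl | ht
      · refine Or.inr ⟨?_, ?_, ?_, Or.inl ⟨rfl, hg⟩⟩
        · rwa [hxd]
        · rw [hxd]
          exact mem_sp_of_mem (by simp)
        · exact fun h' => hw (add_right_cancel h').symm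
      · exact Or.inr (hF ht)
    · rw [hC2 g hg] at ht
      rcases ht with ht | ht
      · exact Or.inl ⟨(hE3 _ g.2 t ht).1, ht, (hE3 _ g.2 t ht).2⟩
      · exact Or.inr (hF ht)
  have main : IsPacking (d :: l) {x, y, w + d} C := by
    constructor
    · intro g
      refine ⟨?_, ?_, ?_⟩
      · by_cases hg : x + g.1 = y
        · have hgw : x + g.1 ≠ w := fun h' => hwy (h'.symm.trans hg)
          obtain ⟨h1, h2, -⟩ := hF1 _ g.2 hgw
          rw [hC1 g hg]
          refine ((h1.mono hgg).translate d).insert (a := x + g.1 + d) ?_ ?_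
          · rwa [Set.mem_ofPred_eq, add_cancel_right]
          · rw [add_add_add_cancel, add_self_left]
            exact hgg g.2
        · obtain ⟨h1, h2, -⟩ := hE1 _ g.2 hg
          rw [hC2 g hg]
          by_cases hgw : x + g.1 = w
          · have h3 : {t | t + d ∈ F g.1} = ∅ := by
              rw [hF2 _ g.2 hgw]
              rfl
            rw [h3, Set.union_empty]
            exact h1.mono hgg
          · obtain ⟨h3, h4, -⟩ := hF1 _ g.2 hgw
            refine (h1.mono hgg).union ((h3.mono hgg).translate d) h2 (b := x + g.1 + d) ?_ ?_
            · rwa [Set.mem_ofPred_eq, add_cancel_right]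
            · rwa [add_self_left]
      · intro t ht
        have hts : t + x ∈ sp (d :: l) := by
          rcases hmem g t ht with h1 | h1
          · exact sp_le_cons _ _ h1.1
          · exact h1.2.1
        have hS : ∀ s ∈ ({x, y, w + d} : Set V), s + x ∈ sp (d :: l) := by
          rintro s (rfl | rfl | rfl)
          · rw [ZModModule.add_self]
            exact zero_mem _
          · exact sp_le_cons _ _ hyx
          · rw [add_right_comm]
            exact add_mem (sp_le_cons _ _ hwx) (mem_sp_of_mem (by simp))
        refine ⟨?_, fun s hs => ?_⟩
        · rcases hmem g t ht with ⟨h1, -, h2, h3⟩ | ⟨h1, -, h2, -⟩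
          · rintro (rfl | rfl | rfl)
            · exact h2 rfl
            · exact h3 rfl
            · rw [add_right_comm] at h1
              exact hd ((Submodule.add_mem_iff_right _ hwx).1 h1)
          · rintro (rfl | rfl | rfl)
            · rw [ZModModule.add_self] at h1
              exact h1 (zero_mem _)
            · exact h1 hyx
            · exact h2 rfl
        · have := add_mem hts (hS s hs)
          rwa [add_add_add_cancel] at this
      · have hFw : x + g.1 ≠ w → ∃ t, t + d ∈ F g.1 ∧ w + d + t ∈ gens (d :: l) := by
          intro hgw
          obtain ⟨-, -, t, ht, hwt⟩ := hF1 _ g.2 hgw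
          refine ⟨t + d, by rwa [add_cancel_right], ?_⟩
          rw [add_add_add_cancel]
          exact hgg hwt
        rintro s (rfl | rfl | rfl)
        · by_cases hg : s + g.1 = y
          · rw [hC1 g hg]
            exact ⟨s + d, Or.inl rfl, by rwa [add_self_left]⟩
          · rw [hC2 g hg]
            exact ⟨s + g.1, Or.inl (hE1 _ g.2 hg).2.1, by rw [add_self_left]; exact hgg g.2⟩
        · by_cases hg : x + g.1 = s
          · rw [hC1 g hg]
            refine ⟨s + d, Or.inr ?_, by rwa [add_self_left]⟩
            rw [Set.mem_ofPred_eq, add_cancel_right, ← hg]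
            exact (hF1 _ g.2 fun h' => hwy (h'.symm.trans hg)).2.1
          · obtain ⟨-, -, t, ht, hst⟩ := hE1 _ g.2 hg
            rw [hC2 g hg]
            exact ⟨t, Or.inl ht, hgg hst⟩
        · by_cases hg : x + g.1 = y
          · obtain ⟨t, ht, hwt⟩ := hFw fun h' => hwy (h'.symm.trans hg)
            rw [hC1 g hg]
            exact ⟨t, Or.inr ht, hwt⟩
          · rw [hC2 g hg]
            by_cases hgw : x + g.1 = w
            -- Here the shifted `F g` is empty, but `E g` contains `w` itself, the partner of `w +
            -- d`.
            · refine ⟨x + g.1, Or.inl (hE1 _ g.2 hg).2.1, ?_⟩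
              rwa [hgw, add_comm w d, add_cancel_right]
            · obtain ⟨t, ht, hwt⟩ := hFw hgw
              exact ⟨t, Or.inr ht, hwt⟩
    · intro g g' t ht ht'
      apply Subtype.ext
      rcases hmem g t ht with ⟨h1, h2, -⟩ | ⟨h1, -, -, h2⟩ <;>
        rcases hmem g' t ht' with ⟨h1', h2', -⟩ | ⟨h1', -, -, h2'⟩
      · exact hE4 _ g.2 _ g'.2 t h2 h2'
      · exact absurd h1 h1'
      · exact absurd h1' h1
      · rcases h2 with ⟨rfl, h2⟩ | ⟨h2, h3⟩ <;> rcases h2' with ⟨h4, h2'⟩ | ⟨h2', h3'⟩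
        · exact add_left_cancel (h2.trans h2'.symm)
        · exact absurd (add_cancel_right _ _) h3'
        · rw [h4] at h3
          exact absurd (add_cancel_right _ _) h3
        · exact hF4 _ g.2 _ g'.2 _ h2 h2'
  have := (gens_finite l).to_subtype
  rw [← Nat.card_coe_set_eq]
  exact main.packs

/-- A linking of one half of a cube, from `u` to `w`, gives a linking from `u` to the neighbor
`w + d` of `w` in the other half. -/
theorem Linked.cross {d e f : V} {m : List V} (h : Indep (d :: e :: f :: m)) {u w : V}
    (hwu : w + u ∈ sp (f :: m)) (hw : w ≠ u) (hwf : w ≠ u + f)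
    (hL : Linked (e :: f :: m) u w) : Linked (d :: e :: f :: m) u (w + d) := by
  classical
  obtain ⟨E, h1, h2, h3, h4⟩ := hL
  have hd := h.head_notMem
  have he := h.tail.head_notMem
  have hf0 := h.tail.tail.head_ne_zero
  have hfm : f ∈ sp (f :: m) := mem_sp_of_mem (by simp)
  have hem : e ∈ sp (e :: f :: m) := mem_sp_of_mem (by simp)
  have hdg : d ∈ gens (d :: e :: f :: m) := head_mem_gens _ _
  have heg : e ∈ gens (e :: f :: m) := head_mem_gens _ _
  have hdeg : d + e ∈ gens (d :: e :: f :: m) := mem_gens_cons_cons.2 (Or.inr (Or.inl rfl))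
  have hgg := gens_subset_cons d (e :: f :: m)
  have hgg' := (gens_subset_cons e (f :: m)).trans hgg
  have hgs := gens_subset_sp (e :: f :: m)
  have hss := sp_le_cons e (f :: m)
  have hss' := sp_le_cons d (e :: f :: m)
  have huu : u + u ∈ sp (f :: m) := by
    rw [ZModModule.add_self]
    exact zero_mem _
  -- `P` joins `u` to `w` inside the quarter of `u` and then crosses along `d`. Because it meets
  -- only one neighbor `u + p` of `u`, the other directions at `u` remain free.
  obtain ⟨P, hPA, hP, hwP, huP, p', hpP, hup, hpu⟩ :=
    (conn_coset (f :: m) u).exists_subset_unique_neighbor (u := u) (w := w) huu hwu hw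
  obtain ⟨p, rfl⟩ : ∃ p, p' = u + p := ⟨u + p', (add_self_left _ _).symm⟩
  rw [add_self_left] at hup
  have hps : p ∈ sp (f :: m) := gens_subset_sp _ hup
  have hpg : p ∈ gens (e :: f :: m) := gens_subset_cons _ _ hup
  -- `Q` is the quarter of `u + e` without `u + (e + f)`, which is reserved as the start in
  -- direction `e + f`. It joins `u + e` to `w + e`, a neighbor of `w + d` along `d + e`; the
  -- assumption `w ≠ u + f` keeps `w + e` in `Q`.
  have hQ := h.tail.tail.conn_coset_diff_singleton (u + (e + f))
  set Q := {t | t + (u + (e + f)) ∈ sp (f :: m)} \ {u + (e + f)} with hQdef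
  have hQm : ∀ t, t ∈ Q ↔ t + u + e ∈ sp (f :: m) ∧ t ≠ u + (e + f) := by
    intro t
    rw [hQdef, Set.mem_sdiff, Set.mem_ofPred_eq, Set.mem_singleton_iff, ← add_assoc, ← add_assoc,
      Submodule.add_mem_iff_left _ hfm]
  have hQu : ∀ t ∈ Q, t + u ∉ sp (f :: m) := fun t ht h' =>
    he ((Submodule.add_mem_iff_right _ h').1 ((hQm t).1 ht).1)
  have hQl : ∀ t ∈ Q, t + u ∈ sp (e :: f :: m) := fun t ht =>
    mem_sp_cons.2 (Or.inr ((hQm t).1 ht).1)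
  have hde : d + e ∉ sp (e :: f :: m) := fun h => hd ((Submodule.add_mem_iff_left _ hem).1 h)
  have hne : d + e ≠ d := fun h' => h.tail.head_ne_zero (by simpa using h')
  have hpe : p ≠ e := by
    rintro rfl
    exact he hps
  have hnd : ∀ g ∈ gens (e :: f :: m), g ≠ d := by
    rintro _ hg rfl
    exact hd (hgs hg)
  have hnde : ∀ g ∈ gens (e :: f :: m), g ≠ d + e := by
    rintro _ hg rfl
    exact hde (hgs hg)
  have hPg : ∀ g ∈ gens (e :: f :: m), u + g ∈ P → g = p := by
    intro g hg hgP
    have hgm : g ∈ sp (f :: m) := by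
      have := hPA hgP
      rw [Set.mem_ofPred_eq] at this
      rwa [add_comm, add_self_left] at this
    refine add_left_cancel (hpu _ hgP ?_)
    rw [add_self_left]
    rcases mem_gens_cons_cons.1 hg with rfl | rfl | hg
    · exact absurd hgm he
    · exact absurd ((Submodule.add_mem_iff_left _ hfm).1 hgm) he
    · exact hg
  have hQg : ∀ g ∈ gens (e :: f :: m), u + g ∈ Q → g = e := by
    intro g hg hgQ
    rcases mem_gens_cons_cons.1 hg with rfl | rfl | hg
    · rfl
    · exact absurd rfl ((hQm _).1 hgQ).2
    · refine absurd (gens_subset_sp _ hg) ?_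
      have := hQu _ hgQ
      rwa [add_comm, add_self_left] at this
  have hgw : ∀ g ∈ gens (e :: f :: m), u + g = w → g = p := fun g hg hgw =>
    hPg g hg (hgw ▸ hwP)
  have hue : u + e ≠ w := fun h' => hpe (hgw e heg h').symm
  -- Directions `p` and `e` use `P` and `Q` in the near half, so the shifted `E p` and `E e` become
  -- available for the new directions `d` and `d + e`. Every other direction `g` crosses at once
  -- from `u + g` and continues in the shifted `E g`.
  obtain ⟨E', hE1, hE2, hE3, hE4, hE5⟩ : ∃ E' : V → Set V,
      E' d = insert (u + d) {t | t + d ∈ E p} ∧ E' (d + e) = {t | t + d ∈ E e} ∧ E' e = Q ∧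
      E' p = P ∧ ∀ g ∈ gens (e :: f :: m), g ≠ e → g ≠ p →
        E' g = insert (u + g) {t | t + d ∈ E g} := by
    refine ⟨fun g => if g = d then insert (u + d) {t | t + d ∈ E p} else
      if g = d + e then {t | t + d ∈ E e} else if g = e then Q else if g = p then P else
      insert (u + g) {t | t + d ∈ E g}, if_pos rfl, ?_, ?_, ?_, ?_⟩
    · exact (if_neg hne).trans (if_pos rfl)
    · exact (if_neg (hnd e heg)).trans ((if_neg (hnde e heg)).trans (if_pos rfl))
    · exact (if_neg (hnd p hpg)).trans ((if_neg (hnde p hpg)).trans ((if_neg hpe).trans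
        (if_pos rfl)))
    · exact fun g hg hge hgp => (if_neg (hnd g hg)).trans ((if_neg (hnde g hg)).trans
        ((if_neg hge).trans (if_neg hgp)))
  have cases_gens : ∀ g ∈ gens (d :: e :: f :: m), g = d ∨ g = d + e ∨ g = e ∨ g = p ∨
      (g ∈ gens (e :: f :: m) ∧ g ≠ e ∧ g ≠ p) := by
    intro g hg
    rcases mem_gens_cons_cons.1 hg with h | h | h
    · exact Or.inl h
    · exact Or.inr (Or.inl h)
    · tauto
  have hEd : ∀ g ∈ gens (e :: f :: m), ∀ t, t + d ∈ E g →
      t + u ∉ sp (e :: f :: m) ∧ t + u ∈ sp (d :: e :: f :: m) ∧ t ≠ u + d ∧ t ≠ w + d := by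
    intro g hg t ht
    obtain ⟨h5, h6, h7⟩ := h3 g hg _ ht
    rw [add_right_comm] at h5
    refine ⟨fun h' => hd ((Submodule.add_mem_iff_right _ h').1 h5), mem_sp_cons.2 (Or.inr h5),
      ?_, ?_⟩
    · rintro rfl
      exact h6 (add_cancel_right _ _)
    · rintro rfl
      exact h7 (add_cancel_right _ _)
  have hgu : ∀ g, u + g + u = g := fun g => by rw [add_comm, add_self_left]
  have hmem : ∀ g ∈ gens (d :: e :: f :: m), ∀ t ∈ E' g,
      (t + u ∈ sp (e :: f :: m) ∧ t ≠ u ∧ ((g = e ∧ t ∈ Q) ∨ (g = p ∧ t ∈ P) ∨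
        (g ∈ gens (e :: f :: m) ∧ g ≠ e ∧ g ≠ p ∧ t = u + g))) ∨
      (t + u ∉ sp (e :: f :: m) ∧ t + u ∈ sp (d :: e :: f :: m) ∧ t ≠ w + d ∧
        ((g = d ∧ t = u + d) ∨ (t ≠ u + d ∧ ∃ k ∈ gens (e :: f :: m), t + d ∈ E k ∧
          ((g = d ∧ k = p) ∨ (g = d + e ∧ k = e) ∨
            (g ≠ d ∧ g ≠ d + e ∧ k ≠ e ∧ k ≠ p ∧ k = g))))) := by
    intro g hg t ht
    rcases cases_gens g hg with rfl | rfl | rfl | rfl | ⟨hg1, hge, hgp⟩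
    · rw [hE1] at ht
      rcases ht with rfl | ht
      · refine Or.inr ⟨by rwa [hgu], ?_, ?_, Or.inl ⟨rfl, rfl⟩⟩
        · rw [hgu]
          exact mem_sp_of_mem (by simp)
        · exact fun h' => hw (add_right_cancel h').symm
      · obtain ⟨h5, h6, h7, h8⟩ := hEd p hpg t ht
        exact Or.inr ⟨h5, h6, h8, Or.inr ⟨h7, p, hpg, ht, Or.inl ⟨rfl, rfl⟩⟩⟩
    · rw [hE2] at ht
      obtain ⟨h5, h6, h7, h8⟩ := hEd e heg t ht
      exact Or.inr ⟨h5, h6, h8, Or.inr ⟨h7, e, heg, ht, Or.inr (Or.inl ⟨rfl, rfl⟩)⟩⟩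
    · rw [hE3] at ht
      refine Or.inl ⟨hQl t ht, ?_, Or.inl ⟨rfl, ht⟩⟩
      rintro rfl
      exact hQu _ ht huu
    · rw [hE4] at ht
      refine Or.inl ⟨hss (hPA ht), ?_, Or.inr (Or.inl ⟨rfl, ht⟩)⟩
      rintro rfl
      exact huP ht
    · rw [hE5 g hg1 hge hgp] at ht
      rcases ht with rfl | ht
      · refine Or.inl ⟨?_, ?_, Or.inr (Or.inr ⟨hg1, hge, hgp, rfl⟩)⟩
        · rw [hgu]
          exact hgs hg1
        · intro h'
          obtain rfl : g = 0 := by simpa using h'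
          exact h.tail.zero_notMem_gens hg1
      · obtain ⟨h5, h6, h7, h8⟩ := hEd g hg1 t ht
        exact Or.inr ⟨h5, h6, h8, Or.inr ⟨h7, g, hg1, ht,
          Or.inr (Or.inr ⟨hnd g hg1, hnde g hg1, hge, hgp, rfl⟩)⟩⟩
  have hwd : w + d + u ∉ sp (e :: f :: m) := by
    rw [add_right_comm]
    exact fun h' => hd ((Submodule.add_mem_iff_right _ (hss hwu)).1 h')
  have conn_insert : ∀ g ∈ gens (e :: f :: m), u + g ≠ w → ∀ x,
      x + (u + g + d) ∈ gens (d :: e :: f :: m) →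
      Conn (d :: e :: f :: m) (insert x {t | t + d ∈ E g}) ∧
        ∃ t ∈ insert x {t | t + d ∈ E g}, w + d + t ∈ gens (d :: e :: f :: m) := by
    intro g hg hgw x hx
    obtain ⟨h5, h6, t, ht, hwt⟩ := h1 g hg hgw
    refine ⟨((h5.mono hgg).translate d).insert (a := u + g + d) ?_ hx, t + d, Or.inr ?_, ?_⟩
    · rwa [Set.mem_ofPred_eq, add_cancel_right]
    · rwa [Set.mem_ofPred_eq, add_cancel_right]
    · rw [add_add_add_cancel]
      exact hgg hwt
  refine ⟨E', ?_, ?_, ?_, ?_⟩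
  · intro g hg _
    rcases cases_gens g hg with rfl | rfl | rfl | rfl | ⟨hg1, hge, hgp⟩
    · rw [hE1]
      by_cases hpw : u + p = w
      -- When `u + p = w` the set `E p` is empty, but `u + d` is then itself adjacent to `w + d`.
      · have h5 : {t | t + g ∈ E p} = ∅ := by
          rw [h2 p hpg hpw]
          rfl
        rw [h5, insert_empty_eq]
        refine ⟨conn_singleton _ _, rfl, u + g, rfl, ?_⟩
        rw [add_add_add_cancel, ← hpw, hgu]
        exact hgg hpg
      · obtain ⟨h5, h6⟩ := conn_insert p hpg hpw (u + g) (by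
          rw [add_add_add_cancel, add_self_left]
          exact hgg hpg)
        exact ⟨h5, Set.mem_insert _ _, h6⟩
    · rw [hE2]
      obtain ⟨h5, h6, t, ht, hwt⟩ := h1 e heg hue
      refine ⟨(h5.mono hgg).translate d, ?_, t + d, ?_, ?_⟩
      · rw [Set.mem_ofPred_eq, add_comm d e, ← add_assoc, add_cancel_right]
        exact h6
      · rwa [Set.mem_ofPred_eq, add_cancel_right]
      · rw [add_add_add_cancel]
        exact hgg hwt
    · rw [hE3]
      refine ⟨hQ.mono hgg', (hQm _).2 ⟨?_, ?_⟩, w + g, (hQm _).2 ⟨?_, ?_⟩, ?_⟩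
      · rw [hgu, ZModModule.add_self]
        exact zero_mem _
      · intro h'
        exact hf0 (by simpa using add_left_cancel h')
      · rwa [add_right_comm w g u, add_cancel_right]
      · intro h'
        rw [add_comm g f, ← add_assoc] at h'
        exact hwf (add_right_cancel h')
      · rwa [add_comm w d, add_comm w g, add_add_add_cancel]
    · rw [hE4]
      refine ⟨hP.mono hgg', hpP, w, hwP, ?_⟩
      rwa [add_comm w d, add_cancel_right]
    · rw [hE5 g hg1 hge hgp]
      obtain ⟨h5, h6⟩ := conn_insert g hg1 (fun h' => hgp (hgw g hg1 h')) (u + g) (by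
        rwa [add_self_left])
      exact ⟨h5, Set.mem_insert _ _, h6⟩
  · intro g hg hgv
    rw [← hgv, hgu] at hwd
    rcases mem_gens_cons_cons.1 hg with rfl | rfl | hg
    · exact absurd (add_right_cancel hgv).symm hw
    · rw [add_comm d e, ← add_assoc] at hgv
      exact absurd (add_right_cancel hgv) hue
    · exact absurd (hgs hg) hwd
  · intro g hg t ht
    rcases hmem g hg t ht with ⟨h5, h6, -⟩ | ⟨h5, h6, h7, -⟩
    · refine ⟨hss' h5, h6, ?_⟩
      rintro rfl
      exact hwd h5
    · refine ⟨h6, ?_, h7⟩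
      rintro rfl
      exact h5 (hss huu)
  · intro g hg g' hg' t ht ht'
    rcases hmem g hg t ht with ⟨h5, -, h6⟩ | ⟨h5, -, -, h6⟩ <;>
      rcases hmem g' hg' t ht' with ⟨h5', -, h6'⟩ | ⟨h5', -, -, h6'⟩
    · rcases h6 with ⟨rfl, h6⟩ | ⟨rfl, h6⟩ | ⟨hg1, hge, hgp, rfl⟩ <;>
        rcases h6' with ⟨rfl, h6'⟩ | ⟨rfl, h6'⟩ | ⟨hg1', hge', hgp', h7⟩
      · rfl
      · exact absurd (hPA h6') (hQu t h6)
      · rw [h7] at h6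
        exact absurd (hQg _ hg1' h6) hge'
      · exact absurd (hPA h6) (hQu t h6')
      · rfl
      · rw [h7] at h6
        exact absurd (hPg _ hg1' h6) hgp'
      · exact absurd (hQg _ hg1 h6') hge
      · exact absurd (hPg _ hg1 h6') hgp
      · exact add_left_cancel h7
    · exact absurd h5 h5'
    · exact absurd h5' h5
    · rcases h6 with ⟨hgd, h6⟩ | ⟨h6, k, hk, htk, h7⟩ <;>
        rcases h6' with ⟨hgd', h6'⟩ | ⟨h6', k', hk', htk', h7'⟩
      · rw [hgd, hgd']
      · exact absurd h6 h6'
      · exact absurd h6' h6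
      · obtain rfl := h4 k hk k' hk' _ htk htk'
        rcases h7 with ⟨h7, h8⟩ | ⟨h7, h8⟩ | ⟨h7, h8, h9, h10, h11⟩ <;>
          rcases h7' with ⟨h7', h8'⟩ | ⟨h7', h8'⟩ | ⟨h7', h8', h9', h10', h11'⟩
        · rw [h7, h7']
        · exact absurd (h8.symm.trans h8') hpe
        · exact absurd h8 h10'
        · exact absurd (h8'.symm.trans h8) hpe
        · rw [h7, h7']
        · exact absurd h8 h9'
        · exact absurd h8' h10
        · exact absurd h8' h9
        · rw [← h11, ← h11']

end AugmentedCube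

/-! ### Explicit certificates in dimensions three and four. -/

namespace AugmentedCube

/-- The connection set of the standard sequence of length `k`, where vectors are written as the
binary digits of natural numbers. -/
def gensNat : ℕ → List ℕ
  | 0 => []
  | 1 => [1]
  | k + 2 => 1 :: 3 :: (gensNat (k + 1)).map (2 * ·)

/-- Each member of the list except the last one is adjacent to a later one. -/
def connList (k : ℕ) : List ℕ → Bool
  | [] => false
  | [_] => true
  | v :: w :: L => connList k (w :: L) && (w :: L).any fun a => (gensNat k).contains (v ^^^ a)

/-- The lists in `Ls` describe a packing for `S` in the cube of dimension `k`. -/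
def packCert (k : ℕ) (S : List ℕ) (Ls : List (List ℕ)) : Bool :=
  Ls.flatten.Nodup && Ls.all fun L =>
    connList k L && (L.all fun n => n < 2 ^ k && !S.contains n) &&
      S.all fun s => L.any fun n => (gensNat k).contains (s ^^^ n)

/-- The lists `c g` describe a linking from `0` to `v` in the cube of dimension `k`. -/
def linkCert (k v : ℕ) (c : ℕ → List ℕ) : Bool :=
  (gensNat k).all fun g =>
    (if g = v then (c g).isEmpty else connList k (c g) && (c g).contains g &&
      (c g).any fun n => (gensNat k).contains (v ^^^ n)) &&
    ((c g).all fun n => n < 2 ^ k && n != 0 && n != v) &&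
    (gensNat k).all fun g' => g == g' || (c g).all fun n => !(c g').contains n

/-- Packings in the cube of dimension three. -/
def packTable3 : List (List (List ℕ)) :=
  [[[3], [4], [6]], [[3], [5, 4], [7, 6]], [[2], [5, 4], [7, 6]], [[2], [7, 3], [6, 5]],
   [[4, 2], [3], [7, 6]], [[2], [5, 3], [7, 4]], [[6, 2], [3], [5, 4]], [[1], [5, 4], [7, 6]],
   [[7, 1], [5, 3], [6]], [[5, 1], [7, 3], [4]], [[7, 1], [2], [6, 5]], [[1], [6, 2], [7, 4]],
   [[7, 1], [2], [5, 4]], [[1], [6, 2], [5, 4]], [[7, 1], [3, 2], [6]], [[7, 1], [2], [5, 3]],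
   [[5, 1], [3, 2], [6]], [[2, 1], [7, 3], [4]], [[2, 1], [5, 3], [4]]]

/-- Packings in the cube of dimension four. -/
def packTable4 : List (List (List ℕ)) :=
  [[[11, 13, 1], [3, 2], [12, 4], [6], [15, 9, 8]],
   [[1], [15, 3], [14, 8, 4], [6, 5], [12, 11, 10]],
   [[14, 2], [11, 3], [7, 4], [9, 10, 6], [13, 12]],
   [[10, 2], [15, 3], [5, 4], [13, 14, 6], [8, 11, 7]],
   [[14, 2], [11, 3], [12, 7, 4], [6, 5], [9, 8]], [[7, 1], [3], [13, 6, 5], [14, 8], [12, 10]],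
   [[9, 1], [14, 2], [5, 4], [11, 7, 6], [15, 12]],
   [[13, 1], [10, 2], [8, 9, 5], [7, 6], [15, 12]],
   [[10, 9, 1], [14, 2], [7, 4], [13, 6, 5], [11, 8]], [[7, 1], [5, 3], [10, 6], [8], [13, 12]],
   [[7, 1], [14, 2], [5, 3], [11, 8], [12]], [[10, 4, 2], [3], [7, 6], [9, 8], [13, 12]],
   [[14, 2, 1], [11, 3], [15, 7, 4], [10, 6], [13, 12]],
   [[9, 1], [14, 3, 2], [13, 5, 4], [10, 6], [15, 12]],
   [[10, 2, 1], [15, 3], [11, 7, 4], [14, 6], [9, 8]],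
   [[10, 2], [15, 3], [6, 5], [8, 11, 7], [13, 12]], [[7, 1], [3], [12, 4], [14, 6], [10, 9, 8]],
   [[9, 1], [13, 14, 2], [8, 5, 4], [7, 6], [15, 12]],
   [[2, 1], [11, 7, 3], [6, 5], [8], [15, 12]], [[2, 1], [15, 7, 3], [6, 5], [11, 8], [12]],
   [[7, 1], [10, 2], [5, 3], [8, 4], [14, 13, 12]],
   [[7, 1], [14, 2], [5, 3], [9, 8, 4], [12, 10]], [[9, 1], [7, 4, 2], [11, 3], [14, 6], [12]],
   [[13, 1], [7, 4, 2], [15, 3], [10, 6], [8]],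
   [[13, 1], [10, 3, 2], [9, 5, 4], [14, 6], [11, 8]],
   [[3], [5, 4], [7, 6], [14, 9, 8], [13, 12, 10]],
   [[2], [5, 4], [7, 6], [11, 9, 8], [15, 13, 12]], [[2], [5, 3], [7, 6], [9, 8], [13, 12]],
   [[2], [7, 3], [5, 4], [13, 14, 8], [12, 10, 9]],
   [[15, 14, 2], [3], [9, 10, 12, 4], [6, 5], [13, 11, 8]],
   [[1], [5, 4], [7, 6], [14, 11, 8], [15, 12, 10]], [[7, 1], [5, 3], [6], [10, 8], [14, 12]],
   [[7, 1], [5, 3], [4], [14, 8], [12, 10]], [[9, 1], [11, 3], [4], [10, 6], [14, 12]],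
   [[9, 1], [11, 3], [12, 4], [6], [14, 8]], [[13, 1], [15, 3], [4], [10, 6], [14, 8]],
   [[13, 1], [15, 3], [12, 4], [6], [10, 8]], [[7, 1], [2], [6, 5], [11, 8], [15, 12]],
   [[1], [4, 2], [7, 6], [15, 9, 8], [12, 13, 11]],
   [[5, 1], [2], [7, 4], [11, 10, 8], [15, 14, 12]], [[1], [6, 2], [5, 4], [11, 8], [15, 12]],
   [[14, 13, 1], [10, 2], [5, 4], [11, 7, 6], [15, 12]],
   [[13, 1], [9, 10, 2], [12, 5, 4], [7, 6], [11, 8]], [[2, 1], [7, 3], [6], [9, 8], [13, 12]],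
   [[5, 1], [2], [7, 3], [14, 8], [12, 10]], [[2, 1], [5, 3], [6], [11, 8], [15, 12]],
   [[9, 5, 1], [14, 2], [11, 7, 3], [10, 6], [12]],
   [[13, 7, 1], [14, 2], [15, 5, 3], [10, 6], [8]],
   [[7, 1], [3, 2], [4], [14, 9, 8], [13, 12, 10]],
   [[5, 1], [3, 2], [4], [14, 11, 8], [15, 12, 10]],
   [[9, 5, 1], [10, 2], [11, 7, 3], [4], [14, 12]],
   [[9, 7, 1], [2], [11, 5, 3], [8, 4], [14, 12]],
   [[15, 7, 1], [14, 2], [13, 5, 3], [4], [10, 8]],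
   [[13, 7, 1], [2], [15, 5, 3], [12, 4], [10, 8]],
   [[11, 13, 1], [10, 2], [9, 15, 3], [4], [14, 6]],
   [[15, 9, 1], [10, 2], [13, 11, 3], [6, 4], [12]],
   [[7, 1], [5, 3], [13, 14, 6], [11, 8], [12, 10]],
   [[11, 13, 1], [14, 2], [9, 15, 3], [6, 4], [8]],
   [[7, 1], [14, 10, 2], [5, 3], [9, 8], [15, 12]]]

/-- The entry at `v` lists the connections from `0` to `v` in the cube of dimension four that have
more than one inner vertex. -/
def linkTable : List (List (List ℕ)) :=
  [[], [[4, 7], [8, 9], [6, 5], [12, 13]], [[8, 14], [12, 10]],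
   [[4, 7], [8, 11], [6, 5], [12, 15]], [[1, 7], [3, 5]], [[2, 14, 13], [8, 9], [12, 15, 7]],
   [[1, 7], [8, 14], [3, 5], [12, 10]], [[2, 14, 15], [8, 11], [12, 13, 5]],
   [[1, 9], [2, 14], [3, 11], [6, 10]], [[2, 10], [4, 5], [3, 15], [6, 7, 11], [12, 13]],
   [[1, 9], [4, 7, 11], [3, 15, 14]], [[1, 13], [2, 10], [4, 7], [6, 5, 9], [12, 15]],
   [[1, 13], [2, 14], [3, 15], [6, 10]], [[2, 14], [4, 5], [8, 11], [3, 15], [6, 10, 9]],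
   [[1, 13], [4, 7, 15], [3, 11, 10]], [[1, 13], [2, 14], [4, 7], [8, 11], [6, 10, 9]]]

/-- The connection from `0` to `v` through `g` in the cube of dimension four. -/
def link (v g : ℕ) : List ℕ :=
  -- A listed connection is recognized by its first entry, the neighbor of `0` where it starts. An
  -- unlisted one is empty for the edge from `0` to `v`, and otherwise the common neighbor `g`
  -- alone.
  ((linkTable.getD v []).find? fun L => L.head? == some g).getD (if g = v then [] else [g])

theorem packTable3_spec : ∀ a < 8, ∀ b < 8, 0 < a → a < b →
    ∃ Ls ∈ packTable3, Ls.length = 3 ∧ packCert 3 [0, a, b] Ls := by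
  decide +kernel

/-- Dimension four needs its own table: the inductive step would require full linkings in a half of
dimension three, and those need not exist. -/
theorem packTable4_spec : ∀ a < 16, ∀ b < 16, 0 < a → a < b →
    ∃ Ls ∈ packTable4, Ls.length = 5 ∧ packCert 4 [0, a, b] Ls := by
  decide +kernel

/-- Linkings start in dimension four because in dimension three the four vertices 1, 3, 4, 6
separate 0 from 5, although the degree is five. -/
theorem link_spec : ∀ v < 16, 0 < v → linkCert 4 v (link v) := by
  decide +kernel

end AugmentedCube

/-! ### Transfer of the certificates to arbitrary independent sequences. -/

namespace AugmentedCube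

variable {V : Type*} [AddCommGroup V]

/-- The combination of the vectors of `l` whose coefficients are the binary digits of `n`. -/
def val : List V → ℕ → V
  | [], _ => 0
  | d :: l, n => (if n % 2 = 1 then d else 0) + val l (n / 2)

theorem val_zero (l : List V) : val l 0 = 0 := by
  induction l with
  | nil => rfl
  | cons d l ih => simp [val, ih]

theorem val_cons_two_mul (d : V) (l : List V) (n : ℕ) : val (d :: l) (2 * n) = val l n := by
  simp [val]

/-- The lowest digit belongs to the head: 1 and 3 label `d` and `d + e`, and doubling a label passes
from the tail to the whole sequence. -/
theorem mem_gens_iff {l : List V} {x : V} : x ∈ gens l ↔ ∃ n ∈ gensNat l.length, val l n = x := by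
  induction l generalizing x with
  | nil => simp [gens_nil, gensNat]
  | cons d l ih =>
    cases l with
    | nil => simp [gens_singleton, gensNat, val, eq_comm]
    | cons e l =>
      have h1 : val (d :: e :: l) 1 = d := by simp [val, val_zero]
      have h3 : val (d :: e :: l) 3 = d + e := by simp [val, val_zero]
      rw [mem_gens_cons_cons, ih]
      simp only [List.length_cons, gensNat, List.mem_cons, List.mem_map, exists_eq_or_imp, h1, h3,
        eq_comm (a := x), exists_exists_and_eq_and, val_cons_two_mul d (e :: l)]

theorem lt_of_mem_gensNat {k n : ℕ} (h : n ∈ gensNat k) : n < 2 ^ k := by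
  induction k generalizing n with
  | zero => simp [gensNat] at h
  | succ k ih =>
    cases k with
    | zero => simp_all [gensNat]
    | succ k =>
      simp only [gensNat, List.mem_cons, List.mem_map] at h
      have h4 : 4 ≤ 2 ^ (k + 1 + 1) := by
        rw [pow_succ, pow_succ]
        have := Nat.pos_of_ne_zero (pow_ne_zero k (two_ne_zero (α := ℕ)))
        omega
      rcases h with rfl | rfl | ⟨m, hm, rfl⟩
      · omega
      · omega
      · have := ih hm
        rw [pow_succ]
        omega

variable [Module (ZMod 2) V]

theorem val_xor (l : List V) (a b : ℕ) : val l (a ^^^ b) = val l a + val l b := by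
  induction l generalizing a b with
  | nil => simp [val]
  | cons d l ih =>
    have h := Nat.xor_mod_two_eq_one (a := a) (b := b)
    rw [val, val, val, Nat.xor_div_two, ih, add_add_add_comm]
    congr 1
    by_cases ha : a % 2 = 1 <;> by_cases hb : b % 2 = 1 <;>
      simp only [ha, hb, h, ZModModule.add_self, if_true, if_false, not_true, not_false_eq_true,
        iff_self, iff_false, false_iff, add_zero, zero_add]

theorem exists_val {l : List V} {x : V} (h : x ∈ sp l) : ∃ n < 2 ^ l.length, val l n = x := by
  induction l generalizing x with
  | nil => exact ⟨0, by simp, by simpa [sp_nil, val, eq_comm] using h⟩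
  | cons d l ih =>
    rw [List.length_cons, pow_succ]
    rcases mem_sp_cons.1 h with h | h
    · obtain ⟨n, hn, rfl⟩ := ih h
      exact ⟨2 * n, by omega, val_cons_two_mul d l n⟩
    · obtain ⟨n, hn, hx⟩ := ih h
      refine ⟨2 * n + 1, by omega, ?_⟩
      have h1 : (2 * n + 1) % 2 = 1 := by omega
      have h2 : (2 * n + 1) / 2 = n := by omega
      rw [val, if_pos h1, h2, hx, add_comm x d, add_self_left]

theorem val_mem_sp (l : List V) (n : ℕ) : val l n ∈ sp l := by
  induction l generalizing n with
  | nil => simp [val]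
  | cons d l ih =>
    refine add_mem ?_ (sp_le_cons _ _ (ih _))
    split
    · exact mem_sp_of_mem (by simp)
    · exact zero_mem _

theorem Indep.eq_zero_of_val {l : List V} (h : Indep l) {n : ℕ} (hn : n < 2 ^ l.length)
    (h0 : val l n = 0) : n = 0 := by
  induction l generalizing n with
  | nil => simpa using hn
  | cons d l ih =>
    rw [List.length_cons, pow_succ] at hn
    rw [val] at h0
    split at h0
    · rw [add_eq_zero_iff] at h0
      exact absurd (h0 ▸ val_mem_sp l _) h.head_notMem
    · rw [zero_add] at h0
      have := ih h.tail (by omega) h0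
      omega

theorem Indep.val_injective {l : List V} (h : Indep l) {a b : ℕ} (ha : a < 2 ^ l.length)
    (hb : b < 2 ^ l.length) (hab : val l a = val l b) : a = b := by
  rw [← Nat.xor_eq_zero_iff]
  refine h.eq_zero_of_val (Nat.xor_lt_two_pow ha hb) ?_
  rw [val_xor, hab, ZModModule.add_self]

theorem val_add_val_mem_gens {l : List V} {a b : ℕ} (h : a ^^^ b ∈ gensNat l.length) :
    val l a + val l b ∈ gens l :=
  mem_gens_iff.2 ⟨a ^^^ b, h, val_xor l a b⟩

/-- The vertices with the labels in `L`, relative to the origin `u`. -/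
def labelled (l : List V) (u : V) (L : List ℕ) : Set V := {t | ∃ n ∈ L, t = u + val l n}

theorem conn_labelled {l : List V} (u : V) {L : List ℕ} (h : connList l.length L) :
    Conn l (labelled l u L) := by
  induction L with
  | nil => simp [connList] at h
  | cons v L ih =>
    cases L with
    | nil =>
      have : labelled l u [v] = {u + val l v} := by
        ext t
        simp [labelled]
      rw [this]
      exact conn_singleton _ _
    | cons w L =>
      simp only [connList, Bool.and_eq_true, List.any_eq_true, List.contains_iff_mem] at h
      obtain ⟨h1, a, ha, hva⟩ := h
      have : labelled l u (v :: w :: L) = insert (u + val l v) (labelled l u (w :: L)) := by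
        ext t
        simp [labelled]
      rw [this]
      refine (ih h1).insert ⟨a, ha, rfl⟩ ?_
      rw [add_add_add_comm, ZModModule.add_self, zero_add]
      exact val_add_val_mem_gens hva

theorem add_val_add_mem_sp (l : List V) (u : V) (a b : ℕ) :
    u + val l a + (u + val l b) ∈ sp l := by
  rw [add_add_add_comm, ZModModule.add_self, zero_add]
  exact add_mem (val_mem_sp _ _) (val_mem_sp _ _)

theorem add_val_add_mem_gens {l : List V} (u : V) {a b : ℕ} (h : a ^^^ b ∈ gensNat l.length) :
    u + val l a + (u + val l b) ∈ gens l := by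
  rw [add_add_add_comm, ZModModule.add_self, zero_add]
  exact val_add_val_mem_gens h

theorem Indep.packs_of_packCert {l : List V} (h : Indep l) (u : V) {S : List ℕ}
    (hS : ∀ s ∈ S, s < 2 ^ l.length) {Ls : List (List ℕ)} (hc : packCert l.length S Ls) :
    Packs l (labelled l u S) Ls.length := by
  simp only [packCert, Bool.and_eq_true, decide_eq_true_eq, List.all_eq_true, List.any_eq_true,
    List.contains_iff_mem, Bool.not_eq_true', List.nodup_flatten] at hc
  obtain ⟨⟨-, hnd⟩, hL⟩ := hc
  refine ⟨fun i => labelled l u Ls[i], fun i => ?_, ?_⟩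
  · obtain ⟨⟨h1, h2⟩, h3⟩ := hL Ls[i] (List.getElem_mem _)
    refine ⟨conn_labelled u h1, ?_, ?_⟩
    · rintro t ⟨n, hn, rfl⟩
      obtain ⟨h4, h5⟩ := h2 n hn
      refine ⟨?_, ?_⟩
      · rintro ⟨s, hs, hns⟩
        obtain rfl := h.val_injective h4 (hS s hs) (add_left_cancel hns)
        simp [hs] at h5
      · rintro s ⟨s, hs, rfl⟩
        exact add_val_add_mem_sp l u _ _
    · rintro s ⟨s, hs, rfl⟩
      obtain ⟨n, hn, hsn⟩ := h3 s hs
      exact ⟨_, ⟨n, hn, rfl⟩, add_val_add_mem_gens u hsn⟩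
  · rintro i j t ⟨n, hn, rfl⟩ ⟨n', hn', hnn⟩
    obtain rfl := h.val_injective ((hL _ (List.getElem_mem _)).1.2 n hn).1
      ((hL _ (List.getElem_mem _)).1.2 n' hn').1 (add_left_cancel hnn)
    -- Absence of repetitions in the flattened list is what makes different lists disjoint.
    rw [List.pairwise_iff_getElem] at hnd
    rcases lt_trichotomy i.1 j.1 with hij | hij | hij
    · exact absurd hn' (hnd i.1 j.1 i.2 j.2 hij hn)
    · exact Fin.ext hij
    · exact absurd hn (hnd j.1 i.1 j.2 i.2 hij hn')

theorem Indep.linked_of_linkCert {l : List V} (h : Indep l) (u : V) {v : ℕ}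
    {c : ℕ → List ℕ} (hv : v < 2 ^ l.length)
    (hc : linkCert l.length v c) : Linked l u (u + val l v) := by
  simp only [linkCert, Bool.and_eq_true, Bool.or_eq_true, List.all_eq_true, decide_eq_true_eq,
    bne_iff_ne, beq_iff_eq, Bool.not_eq_true'] at hc
  have hinj : ∀ g ∈ gensNat l.length, ∀ g' ∈ gensNat l.length, val l g = val l g' → g = g' :=
    fun g hg g' hg' => h.val_injective (lt_of_mem_gensNat hg) (lt_of_mem_gensNat hg')
  -- Certificates are indexed by labels and linkings by vectors; by independence at most one `g`
  -- occurs for each `x`.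
  let E : V → Set V := fun x => {t | ∃ g ∈ gensNat l.length, val l g = x ∧ t ∈ labelled l u (c g)}
  have hE : ∀ g ∈ gensNat l.length, E (val l g) = labelled l u (c g) := by
    intro g hg
    ext t
    constructor
    · rintro ⟨g', hg', hgg, ht⟩
      rwa [← hinj g' hg' g hg hgg]
    · exact fun ht => ⟨g, hg, rfl, ht⟩
  refine ⟨E, ?_, ?_, ?_, ?_⟩
  · rintro x hx hxv
    obtain ⟨g, hg, rfl⟩ := mem_gens_iff.1 hx
    have h1 := (hc g hg).1.1
    rw [if_neg (by rintro rfl; exact hxv rfl)] at h1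
    simp only [Bool.and_eq_true, List.any_eq_true, List.contains_iff_mem] at h1
    obtain ⟨⟨h1, h2⟩, n, hn, hvn⟩ := h1
    rw [hE g hg]
    exact ⟨conn_labelled u h1, ⟨g, h2, rfl⟩, _, ⟨n, hn, rfl⟩, add_val_add_mem_gens u hvn⟩
  · rintro x hx hxv
    obtain ⟨g, hg, rfl⟩ := mem_gens_iff.1 hx
    have hgv : g = v := h.val_injective (lt_of_mem_gensNat hg) hv (add_left_cancel hxv)
    have h1 := (hc g hg).1.1
    rw [if_pos hgv, List.isEmpty_iff] at h1
    rw [hE g hg, h1]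
    ext t
    simp [labelled]
  · rintro x hx t ht
    obtain ⟨g, hg, rfl⟩ := mem_gens_iff.1 hx
    rw [hE g hg] at ht
    obtain ⟨n, hn, rfl⟩ := ht
    obtain ⟨⟨h1, h2⟩, h3⟩ := (hc g hg).1.2 n hn
    refine ⟨?_, ?_, ?_⟩
    · rw [add_comm, add_self_left]
      exact val_mem_sp _ _
    · intro h'
      exact h2 (h.eq_zero_of_val h1 (by simpa using h'))
    · exact fun h' => h3 (h.val_injective h1 hv (add_left_cancel h'))
  · rintro x hx x' hx' t ht ht'
    obtain ⟨g, hg, rfl⟩ := mem_gens_iff.1 hx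
    obtain ⟨g', hg', rfl⟩ := mem_gens_iff.1 hx'
    rw [hE g hg] at ht
    rw [hE g' hg'] at ht'
    obtain ⟨n, hn, rfl⟩ := ht
    obtain ⟨n', hn', hnn⟩ := ht'
    obtain rfl := h.val_injective ((hc g hg).1.2 n hn).1.1 ((hc g' hg').1.2 n' hn').1.1
      (add_left_cancel hnn)
    rcases (hc g hg).2 g' hg' with h1 | h1
    · rw [h1]
    · have := h1 n hn
      simp [hn'] at this

/-- Translation gives `x` the label 0, and exchanging `y` and `z` orders the other two labels, so
the table need only treat `0 < a < b`. -/
theorem Indep.packs_three {l : List V} (h : Indep l) {k N : ℕ} (hl : l.length = k)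
    {table : List (List (List ℕ))} (hT : ∀ a < 2 ^ k, ∀ b < 2 ^ k, 0 < a → a < b →
      ∃ Ls ∈ table, Ls.length = N ∧ packCert k [0, a, b] Ls)
    {x y z : V} (hy : y + x ∈ sp l) (hz : z + x ∈ sp l) (hyx : y ≠ x) (hzx : z ≠ x)
    (hyz : y ≠ z) : Packs l {x, y, z} N := by
  subst hl
  have key : ∀ a < 2 ^ l.length, ∀ b < 2 ^ l.length, 0 < a → a < b →
      Packs l {x, x + val l a, x + val l b} N := by
    intro a ha b hb h0 hab
    obtain ⟨Ls, -, rfl, hc⟩ := hT a ha b hb h0 hab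
    have hS : labelled l x [0, a, b] = {x, x + val l a, x + val l b} := by
      ext t
      simp [labelled, val_zero]
    rw [← hS]
    refine h.packs_of_packCert x ?_ hc
    simp only [List.mem_cons, List.not_mem_nil, or_false]
    rintro s (rfl | rfl | rfl)
    · positivity
    · exact ha
    · exact hb
  obtain ⟨a, ha, hay⟩ := exists_val hy
  obtain ⟨b, hb, hbz⟩ := exists_val hz
  obtain rfl : x + val l a = y := by rw [hay, add_comm y x, add_self_left]
  obtain rfl : x + val l b = z := by rw [hbz, add_comm z x, add_self_left]
  have ha0 : a ≠ 0 := by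
    rintro rfl
    simp [val_zero] at hyx
  have hb0 : b ≠ 0 := by
    rintro rfl
    simp [val_zero] at hzx
  have hab : a ≠ b := by
    rintro rfl
    exact hyz rfl
  rcases lt_or_gt_of_ne hab with hab | hab
  · exact key a ha b hb (Nat.pos_of_ne_zero ha0) hab
  · rw [Set.pair_comm]
    exact key b hb a ha (Nat.pos_of_ne_zero hb0) hab

end AugmentedCube

/-! ### The two inductions on the dimension. -/

namespace AugmentedCube

variable {V : Type*} [AddCommGroup V] [Module (ZMod 2) V]

theorem mem_sp_reverse_tail {p s : List V} (hs : s ≠ []) {x : V} (hx : x ∈ p) :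
    x ∈ sp (p ++ s).reverse.tail := by
  refine mem_sp_of_mem ?_
  rw [List.reverse_append, List.tail_append_of_ne_nil (by simpa using hs)]
  simp [hx]

/-- Any two vertices of a cube of dimension at least four are joined by as many internally
disjoint connections as the degree. -/
theorem Indep.linked {l : List V} (h : Indep l) (hl : 4 ≤ l.length) {u v : V}
    (huv : v + u ∈ sp l) (hne : v ≠ u) : Linked l u v := by
  induction hk : l.length using Nat.strong_induction_on generalizing l u v with
  | _ k ih =>
  subst hk
  by_cases h4 : l.length = 4
  · obtain ⟨n, hn, hnv⟩ := exists_val huv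
    obtain rfl : u + val l n = v := by rw [hnv, add_comm v u, add_self_left]
    have hn0 : n ≠ 0 := by
      rintro rfl
      simp [val_zero] at hne
    refine h.linked_of_linkCert u hn (c := link n) ?_
    rw [h4] at hn ⊢
    exact link_spec n hn (Nat.pos_of_ne_zero hn0)
  have same : ∀ (d : V) (m : List V), Indep (d :: m) → m.length + 1 = l.length →
      v + u ∈ sp m → Linked (d :: m) u v := by
    intro d m hm hlen hvu
    cases m with
    | nil => simp at hlen; omega
    | cons e m => exact Linked.cons hm hvu (ih _ (by omega) hm.tail (by omega) hvu hne rfl)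
  -- Dropping the last vector is dropping the head of the reversed sequence, which has the same
  -- connection set. Once this split is known to separate `u` and `v`, `hrev` rules out the
  -- exceptional positions below.
  by_cases hrev : v + u ∈ sp l.reverse.tail
  · rw [← linked_congr (gens_reverse l) (sp_reverse l)]
    have hr := h.reverse
    have hlr := l.length_reverse
    generalize l.reverse = r at *
    cases r with
    | nil => simp at hlr; omega
    | cons d m => exact same d m hr (by simpa using hlr) hrev
  obtain _ | ⟨d, _ | ⟨e, _ | ⟨f, m⟩⟩⟩ := l
  · simp at hl
  · simp at hl
  · simp at hl
  by_cases hfirst : v + u ∈ sp (e :: f :: m)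
  · exact same d _ h rfl hfirst
  have hm : m ≠ [] := by
    rintro rfl
    simp at hl
  -- As the length is at least four, the last vector is none of `d`, `e`, `f`.
  have hmem : ∀ x ∈ [d, e, f], x ∈ sp (d :: e :: f :: m).reverse.tail :=
    fun _ hx => mem_sp_reverse_tail (p := [d, e, f]) (s := m) hm hx
  have hd := hmem d (by simp)
  have he := hmem e (by simp)
  have hf := hmem f (by simp)
  have key : ∀ d', Indep (d' :: e :: f :: m) → d' ∈ sp (d :: e :: f :: m).reverse.tail →
      v + u + d' ∈ sp (f :: m) → Linked (d' :: e :: f :: m) u v := by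
    intro d' hi hd' hv
    have h1 : v + d' ≠ u := by
      intro h'
      apply hrev
      rw [← h', add_self_left]
      exact hd'
    have h2 : v + d' ≠ u + f := by
      intro h'
      apply hrev
      have : v + u = d' + f := by
        rw [← add_cancel_right v d', h', add_right_comm u f d', add_right_comm,
          add_right_comm u d' u, ZModModule.add_self, zero_add]
      rw [this]
      exact add_mem hd' hf
    have h3 : v + d' + u ∈ sp (f :: m) := by rwa [add_right_comm]
    have h4 : 4 ≤ (e :: f :: m).length := by
      simp only [List.length_cons] at *
      omega
    have := Linked.cross hi h3 h1 h2
      (ih _ (by simp) hi.tail h4 (sp_le_cons _ _ h3) h1 rfl)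
    rwa [add_cancel_right] at this
  -- One of the two partners `v + d` and `v + (d + e)` of `v` lies in the quarter of `u`; in the
  -- second case the transvection turns `d + e` into the head.
  rcases mem_sp_cons.1 ((mem_sp_cons.1 huv).resolve_left hfirst) with h1 | h1
  · exact key d h hd h1
  · rw [← linked_congr (gens_transvection d e (f :: m)) (sp_transvection d e (f :: m))]
    refine key (d + e) h.transvection (add_mem hd he) ?_
    rwa [← add_assoc]

/-- In a cube of dimension `n ≥ 3`, each set of three vertices has a packing by `2 n - 3` sets. -/
theorem Indep.packs {l : List V} (h : Indep l) (hl : 3 ≤ l.length) {x y z : V}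
    (hy : y + x ∈ sp l) (hz : z + x ∈ sp l) (hyx : y ≠ x) (hzx : z ≠ x) (hyz : y ≠ z) :
    Packs l {x, y, z} (2 * l.length - 3) := by
  induction hk : l.length using Nat.strong_induction_on generalizing l x y z with
  | _ k ih =>
  subst hk
  by_cases h3 : l.length = 3
  · rw [h3]
    exact h.packs_three h3 packTable3_spec hy hz hyx hzx hyz
  by_cases h4 : l.length = 4
  · rw [h4]
    exact h.packs_three h4 packTable4_spec hy hz hyx hzx hyz
  have same : ∀ (d : V) (m : List V), Indep (d :: m) → m.length + 1 = l.length →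
      y + x ∈ sp m → z + x ∈ sp m → Packs (d :: m) {x, y, z} (2 * l.length - 3) := by
    intro d m hm hlen hy hz
    cases m with
    | nil => simp at hlen; omega
    | cons e m =>
      have := Packs.cons hm (u := x) ?_ (by simp)
        (ih _ (by omega) hm.tail (by omega) hy hz hyx hzx hyz rfl)
      · rwa [show 2 * l.length - 3 = 2 * (e :: m).length - 3 + 2 by omega]
      · rintro s (rfl | rfl | rfl)
        · rw [ZModModule.add_self]
          exact zero_mem _
        · exact hy
        · exact hz
  by_cases hrev : y + x ∈ sp l.reverse.tail ∧ z + x ∈ sp l.reverse.tail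
  · rw [← packs_congr (gens_reverse l) (sp_reverse l)]
    have hr := h.reverse
    have hlr := l.length_reverse
    generalize l.reverse = r at *
    cases r with
    | nil => simp at hlr; omega
    | cons d m => exact same d m hr (by simpa using hlr) hrev.1 hrev.2
  obtain _ | ⟨d, _ | ⟨e, m⟩⟩ := l
  · simp at hl
  · simp at hl
  have hm : m ≠ [] := by
    rintro rfl
    simp at hl
  have hmem : ∀ x ∈ [d, e], x ∈ sp (d :: e :: m).reverse.tail :=
    fun _ hx => mem_sp_reverse_tail (p := [d, e]) (s := m) hm hx
  have hd := hmem d (by simp)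
  have he := hmem e (by simp)
  set R := sp (d :: e :: m).reverse.tail
  have hlen : 4 ≤ (e :: m).length := by
    simp only [List.length_cons] at *
    omega
  have cross : ∀ d', Indep (d' :: e :: m) → ∀ a b c : V, a ≠ b → b + a ∈ sp (e :: m) →
      c + a + d' ∈ sp (e :: m) → c + d' ≠ a → c + d' ≠ b →
      Packs (d' :: e :: m) {a, b, c} (2 * (d :: e :: m).length - 3) := by
    intro d' hi a b c hab hba hca h1 h2
    have h5 : c + d' + a ∈ sp (e :: m) := by rwa [add_right_comm]
    have := Linked.packs hi hba h5 h1 h2 (hi.tail.linked hlen hba hab.symm)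
      (hi.tail.linked hlen h5 h1)
    -- The half of dimension $n-1$ has degree $2(n-1)-1=2n-3$, exactly the required number.
    rw [add_cancel_right, hi.tail.ncard_gens] at this
    exact this
  have split : ∀ a b c : V, ({a, b, c} : Set V) = {x, y, z} → a ≠ b → b + a ∈ sp (e :: m) →
      c + a ∉ sp (e :: m) → c + a ∈ sp (d :: e :: m) → ¬(a + c ∈ R ∧ b + c ∈ R) →
      Packs (d :: e :: m) {x, y, z} (2 * (d :: e :: m).length - 3) := by
    intro a b c hS hab hba hca hca' hR
    have hcd := (mem_sp_cons.1 hca').resolve_left hca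
    rw [← hS]
    by_cases h1 : c + d ≠ a ∧ c + d ≠ b
    · exact cross d h a b c hab hba hcd h1.1 h1.2
    by_cases h2 : c + (d + e) ≠ a ∧ c + (d + e) ≠ b
    · rw [← packs_congr (gens_transvection d e m) (sp_transvection d e m)]
      refine cross (d + e) h.transvection a b c hab hba ?_ h2.1 h2.2
      rw [← add_assoc]
      exact add_mem hcd (mem_sp_of_mem (by simp))
    -- Both partners of `c` lie in `{a, b}`, so these are `c + d` and `c + (d + e)` in some order,
    -- and all three vertices share a half of the last split.
    refine absurd ?_ hR
    have hde : c + d ≠ c + (d + e) := fun h' => h.tail.head_ne_zero (by simpa using h')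
    have hcR : ∀ t, t ∈ R → c + t + c ∈ R := by
      intro t ht
      rwa [add_comm, add_self_left]
    have hdR := hcR d hd
    have hdeR := hcR (d + e) (add_mem hd he)
    rw [← not_or, not_not] at h1 h2
    rcases h1 with rfl | rfl <;> rcases h2 with h2 | h2
    · exact absurd h2.symm hde
    · rw [← h2]
      exact ⟨hdR, hdeR⟩
    · rw [← h2]
      exact ⟨hdeR, hdR⟩
    · exact absurd h2.symm hde
  have hcomm : ∀ a b : V, a + b ∈ R → b + a ∈ R := fun a b hab => add_comm a b ▸ hab
  have htri : ∀ a b c : V, a + b ∈ R → c + b ∈ R → a + c ∈ R := by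
    intro a b c h1 h2
    have := add_mem h1 h2
    rwa [add_add_add_cancel] at this
  by_cases h1 : y + x ∈ sp (e :: m) <;> by_cases h2 : z + x ∈ sp (e :: m)
  · exact same d _ h rfl h1 h2
  · refine split x y z rfl hyx.symm h1 h2 hz ?_
    rintro ⟨h5, h6⟩
    exact hrev ⟨htri y z x h6 h5, hcomm _ _ h5⟩
  · refine split x z y (by rw [Set.pair_comm]) hzx.symm h2 h1 hy ?_
    rintro ⟨h5, h6⟩
    exact hrev ⟨hcomm _ _ h5, htri z y x h6 h5⟩
  -- Now `x` is the vertex on its own, and `y` takes the role of the common origin of the linkings.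
  · have h7 : z + y ∈ sp (e :: m) := by
      have h5 := (mem_sp_cons.1 hy).resolve_left h1
      have h6 := (mem_sp_cons.1 hz).resolve_left h2
      have := add_mem h6 h5
      rwa [add_add_add_cancel, add_add_add_cancel] at this
    refine split y z x ?_ hyz h7 (by rwa [add_comm]) (by rwa [add_comm]) hrev
    ext t
    simp only [Set.mem_insert_iff, Set.mem_singleton_iff]
    tauto

end AugmentedCube

/-! ### Pendant Steiner trees: construction from connected sets, and the degree bound. -/

namespace SimpleGraph

variable {V : Type*} {G : SimpleGraph V}

/-- A connected set `C` off `S` that contains a neighbor of each element of `S` gives rise to a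
pendant `S`-Steiner tree on the vertex set `C ∪ S`. -/
theorem exists_isPendantSteinerTree {S : Finset V} {C : Set V} (hC : (G.induce C).Connected)
    (hCS : ∀ t ∈ C, t ∉ S) (hS : ∀ s ∈ S, ∃ t ∈ C, G.Adj s t) :
    ∃ T : G.Subgraph, IsPendantSteinerTree S T ∧ T.verts = C ∪ S ∧
      ∀ a b, T.Adj a b → a ∈ C ∨ b ∈ C := by
  choose! f hfC hf using hS
  -- Only one edge is kept at each `s ∈ S`, the one to its chosen neighbor `f s` in `C`. Any
  -- spanning tree of `H` then has the elements of `S` as leaves.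
  let H : SimpleGraph ↥(C ∪ (S : Set V)) :=
    { Adj := fun a b => G.Adj a b ∧ ((a.1 ∈ C ∧ b.1 ∈ C) ∨ (a.1 ∈ S ∧ b.1 = f a.1) ∨
        (b.1 ∈ S ∧ a.1 = f b.1))
      symm := ⟨fun a b h => ⟨h.1.symm, by tauto⟩⟩
      loopless := ⟨fun a h => h.1.ne rfl⟩ }
  let φ : G.induce C →g H :=
    { toFun := fun c => ⟨c.1, Or.inl c.2⟩
      map_rel' := fun {a b} h => ⟨h, Or.inl ⟨a.2, b.2⟩⟩ }
  obtain ⟨c₀⟩ := hC.nonempty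
  have hreach : ∀ a : ↥(C ∪ (S : Set V)), H.Reachable a (φ c₀) := by
    have h1 : ∀ c : C, H.Reachable (φ c) (φ c₀) := fun c => (hC.preconnected c c₀).map φ
    rintro ⟨a, ha | ha⟩
    · exact h1 ⟨a, ha⟩
    · have h2 : H.Adj ⟨a, Or.inr ha⟩ (φ ⟨f a, hfC a ha⟩) := ⟨hf a ha, Or.inr (Or.inl ⟨ha, rfl⟩)⟩
      exact h2.reachable.trans (h1 _)
  have hH : H.Connected :=
    { preconnected := fun a b => (hreach a).trans (hreach b).symm
      nonempty := ⟨φ c₀⟩ }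
  obtain ⟨T, hTH, hT⟩ := hH.exists_isTree_le
  let T' : G.Subgraph :=
    { verts := C ∪ S
      Adj := fun a b => ∃ (ha : a ∈ C ∪ (S : Set V)) (hb : b ∈ C ∪ (S : Set V)),
        T.Adj ⟨a, ha⟩ ⟨b, hb⟩
      adj_sub := fun ⟨_, _, h⟩ => (hTH h).1
      edge_vert := fun ⟨ha, _, _⟩ => ha
      symm := ⟨fun _ _ ⟨ha, hb, h⟩ => ⟨hb, ha, h.symm⟩⟩ }
  have hcoe : T'.coe = T := by
    apply SimpleGraph.ext
    funext a b
    apply propext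
    constructor
    · rintro ⟨_, _, h⟩
      exact h
    · exact fun h => ⟨a.2, b.2, h⟩
  have hleaf : ∀ s ∈ S, ∀ b, T'.Adj s b → b = f s := by
    rintro s hs b ⟨ha, hb, h⟩
    rcases (hTH h).2 with h1 | h1 | h1
    · exact absurd hs (hCS s h1.1)
    · exact h1.2
    · exact absurd hs (hCS s (Set.mem_of_eq_of_mem h1.2 (hfC b h1.1)))
  refine ⟨T', ⟨⟨?_, Set.subset_union_right⟩, ?_⟩, rfl, ?_⟩
  · exact hcoe ▸ hT
  · intro s hs
    rw [Set.encard_eq_one]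
    refine ⟨f s, Set.eq_singleton_iff_unique_mem.2 ⟨?_, hleaf s hs⟩⟩
    have hne : (⟨s, Or.inr hs⟩ : ↥(C ∪ (S : Set V))) ≠ φ c₀ := by
      intro h
      exact hCS c₀ c₀.2 (congrArg Subtype.val h ▸ hs)
    obtain ⟨b, hb⟩ : ∃ b, T.Adj ⟨s, Or.inr hs⟩ b := by
      obtain ⟨p⟩ := hT.connected.preconnected ⟨s, Or.inr hs⟩ (φ c₀)
      cases p with
      | nil => exact absurd rfl hne
      | cons h _ => exact ⟨_, h⟩
    have h1 : T'.Adj s b := ⟨Or.inr hs, b.2, hb⟩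
    have h2 := hleaf s hs b h1
    rw [← h2]
    exact h1
  · rintro a b ⟨ha, hb, h⟩
    rcases (hTH h).2 with h1 | h1 | h1
    · exact Or.inl h1.1
    · exact Or.inr (Set.mem_of_eq_of_mem h1.2 (hfC a h1.1))
    · exact Or.inl (Set.mem_of_eq_of_mem h1.2 (hfC b h1.1))

/-- Disjoint connected sets off `S` that contain a neighbor of each element of `S` bound the local
pendant tree-connectivity from below. -/
theorem le_localPendantTreeConnectivity {S : Finset V} {N : ℕ} (C : Fin N → Set V)
    (hC : ∀ i, (G.induce (C i)).Connected) (hCS : ∀ i, ∀ t ∈ C i, t ∉ S)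
    (hS : ∀ i, ∀ s ∈ S, ∃ t ∈ C i, G.Adj s t) (hd : ∀ i j, ∀ t ∈ C i, t ∈ C j → i = j) :
    (N : ℕ∞) ≤ G.localPendantTreeConnectivity S := by
  choose T hT hTv hTe using fun i => exists_isPendantSteinerTree (hC i) (hCS i) (hS i)
  have hinj : Function.Injective T := by
    intro i j hij
    obtain ⟨t⟩ := (hC i).nonempty
    have h1 : t.1 ∈ C j ∪ S := by
      rw [← hTv j, ← hij, hTv i]
      exact Or.inl t.2
    exact hd i j t t.2 (h1.resolve_right (hCS i t t.2))
  have hF : IsPendantSteinerFamily S (Set.range T) := by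
    constructor
    · rintro _ ⟨i, rfl⟩
      exact hT i
    · rintro _ ⟨i, rfl⟩ _ ⟨j, rfl⟩ hij
      have hij : i ≠ j := fun h => hij (h ▸ rfl)
      have hv : ∀ t ∈ C i, t ∉ (T j).verts := by
        intro t ht h
        rw [hTv j] at h
        rcases h with h | h
        · exact hij (hd i j t ht h)
        · exact hCS i t ht h
      constructor
      · rw [Set.eq_empty_iff_forall_notMem]
        rintro e ⟨h1, h2⟩
        induction e with
        | _ a b =>
        rw [Subgraph.mem_edgeSet] at h1 h2
        rcases hTe i a b h1 with h | h
        · exact hv a h h2.fst_mem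
        · exact hv b h h2.snd_mem
      · ext t
        constructor
        · rintro ⟨h1, h2⟩
          rw [hTv i] at h1
          rcases h1 with h1 | h1
          · exact absurd h2 (hv t h1)
          · exact h1
        · intro h
          rw [hTv i, hTv j]
          exact ⟨Or.inr h, Or.inr h⟩
  have hcard : (Set.range T).encard = N := by
    rw [← Set.image_univ, hinj.encard_image, Set.encard_univ]
    simp
  rw [← hcard]
  exact le_iSup₂_of_le (Set.range T) hF le_rfl

/-- Each tree of a family uses a private neighbor of `x ∈ S`, which lies outside of `S` if `S` has
at least three elements. -/
theorem localPendantTreeConnectivity_le {S : Finset V} (hS3 : 2 < S.card) {x : V} (hx : x ∈ S) :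
    G.localPendantTreeConnectivity S ≤ (G.neighborSet x \ S).encard := by
  classical
  have : Nonempty V := ⟨x⟩
  refine iSup₂_le fun F hF => ?_
  have hex : ∀ T ∈ F, ∃ y, T.Adj x y ∧ y ∉ S := by
    intro T hT
    obtain ⟨⟨htree, hST⟩, hdeg⟩ := hF.1 T hT
    obtain ⟨y, hy⟩ := Set.encard_eq_one.1 (hdeg x hx)
    have hxy : T.Adj x y := by
      have : y ∈ T.neighborSet x := by simp [hy]
      exact this
    refine ⟨y, hxy, fun hyS => ?_⟩
    obtain ⟨x', hx'⟩ := Set.encard_eq_one.1 (hdeg y hyS)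
    have hx'x : x = x' := by
      have : x ∈ T.neighborSet y := hxy.symm
      rw [hx'] at this
      exact this
    subst hx'x
    -- If the neighbor `y` of `x` were in `S`, both would have degree one, and the edge between them
    -- would be the whole tree, too small for three elements of `S`.
    have hclosed : ∀ a b : T.verts, T.coe.Reachable a b → (a.1 = x ∨ a.1 = y) →
        (b.1 = x ∨ b.1 = y) := by
      rintro a b ⟨p⟩ ha
      induction p with
      | nil => exact ha
      | @cons a b c hab _ ih =>
        apply ih
        have hab' : b.1 ∈ T.neighborSet a.1 := hab
        rcases ha with ha | ha
        · rw [ha, hy] at hab'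
          exact Or.inr hab'
        · rw [ha, hx'] at hab'
          exact Or.inl hab'
    have hsub : S ⊆ {x, y} := by
      intro z hz
      have := hclosed ⟨x, hST hx⟩ ⟨z, hST hz⟩ (htree.connected.preconnected _ _) (Or.inl rfl)
      simpa using this
    have := (Finset.card_le_card hsub).trans Finset.card_le_two
    omega
  choose! f hf hfS using hex
  have hinj : Set.InjOn f F := by
    intro T hT T' hT' h
    by_contra hne
    have h1 : s(x, f T) ∈ T.edgeSet ∩ T'.edgeSet := by
      refine ⟨hf T hT, ?_⟩
      rw [h]
      exact hf T' hT'
    rw [(hF.2 hT hT' hne).1] at h1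
    exact h1
  rw [← hinj.encard_image]
  refine Set.encard_le_encard ?_
  rintro _ ⟨T, hT, rfl⟩
  exact ⟨(hf T hT).adj_sub, hfS T hT⟩

end SimpleGraph

/-! ### The augmented cube as a Cayley graph, and the conclusion. -/

namespace AugmentedCube

/-- Binary strings form a vector space over the field with two elements. -/
instance binaryModule (n : ℕ) : Module (ZMod 2) (Fin n → Bool) :=
  AddCommGroup.zmodModule (n := 2) fun x => by
    rw [two_smul]
    exact funext fun i => Bool.xor_self (x i)

theorem finrank_binary (n : ℕ) : Module.finrank (ZMod 2) (Fin n → Bool) = n := by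
  have h := Module.card_eq_pow_finrank (K := ZMod 2) (V := Fin n → Bool)
  simp only [Fintype.card_fun, Fintype.card_bool, Fintype.card_fin, ZMod.card] at h
  exact (Nat.pow_right_injective le_rfl h).symm

/-- The strings `0 ⋯ 0 1 ⋯ 1` of length `n`, ordered by increasing number of zeros. -/
def suffixes : (n : ℕ) → List (Fin n → Bool)
  | 0 => []
  | n + 1 => (fun _ => true) :: (suffixes n).map (Fin.cons false)

theorem length_suffixes (n : ℕ) : (suffixes n).length = n := by
  induction n with
  | zero => rfl
  | succ n ih => simp [suffixes, ih]

theorem gens_map {V W : Type*} [AddCommGroup V] [AddCommGroup W] {L : V → W}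
    (hL : ∀ a b, L (a + b) = L a + L b) (l : List V) : gens (l.map L) = L '' gens l := by
  induction l with
  | nil => simp [gens_nil]
  | cons d l ih =>
    cases l with
    | nil => simp [gens_singleton]
    | cons e l =>
      ext x
      rw [List.map_cons] at ih
      simp only [List.map_cons, mem_gens_cons_cons, ih, Set.mem_image, or_and_right, exists_or,
        exists_eq_left, hL, eq_comm (a := x)]

theorem mem_sp_map {V W : Type*} [AddCommGroup V] [AddCommGroup W] [Module (ZMod 2) V]
    [Module (ZMod 2) W] {L : V → W} (hL : ∀ a b, L (a + b) = L a + L b) {l : List V} {x : V}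
    (hx : x ∈ sp l) : L x ∈ sp (l.map L) := by
  induction l generalizing x with
  | nil =>
    obtain rfl : x = 0 := by simpa [sp_nil] using hx
    have h := hL 0 0
    rw [add_zero, left_eq_add] at h
    rw [h]
    exact zero_mem _
  | cons d l ih =>
    rw [List.map_cons, mem_sp_cons, ← hL]
    exact (mem_sp_cons.1 hx).imp ih ih

theorem cons_false_add {n : ℕ} (a b : Fin n → Bool) :
    (Fin.cons false (a + b) : Fin (n + 1) → Bool) = Fin.cons false a + Fin.cons false b := by
  funext i
  cases i using Fin.cases with
  | zero => rfl
  | succ i => rfl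

/-- Adding the all-ones string, if necessary, clears the first letter and leaves a string of smaller
length. -/
theorem sp_suffixes (n : ℕ) : sp (suffixes n) = ⊤ := by
  induction n with
  | zero => exact Subsingleton.elim _ _
  | succ n ih =>
    rw [eq_top_iff]
    rintro x -
    have key : ∀ y : Fin (n + 1) → Bool, y 0 = false →
        y ∈ sp ((suffixes n).map (Fin.cons (α := fun _ => Bool) false)) := by
      intro y hy
      rw [← Fin.cons_self_tail y, hy]
      exact mem_sp_map cons_false_add (ih ▸ Submodule.mem_top)
    rw [suffixes, mem_sp_cons]
    rcases h : x 0 with _ | _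
    · exact Or.inl (key x h)
    · refine Or.inr (key _ ?_)
      rw [Pi.add_apply, h]
      rfl

theorem indep_suffixes (n : ℕ) : Indep (suffixes n) := by
  rw [Indep, sp_suffixes, finrank_top, finrank_binary, length_suffixes]

/-- Adding `0⋯01⋯1` complements a tail of the string, as a complementary edge does; two consecutive
such strings sum to a string with a single one, which gives a hypercube edge. -/
theorem adj_iff {n : ℕ} {x y : Fin n → Bool} :
    (augmentedCube n).Adj x y ↔ x + y ∈ gens (suffixes n) := by
  induction n with
  | zero => simp [augmentedCube, suffixes, gens_nil]
  | succ n ih =>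
    cases n with
    | zero =>
      have h : gens (suffixes 1) = {fun _ => true} := gens_singleton _
      rw [h, Set.mem_singleton_iff]
      change x ≠ y ↔ _
      revert x y
      decide
    | succ n =>
      have h1 : x + y = (fun _ => true) ↔
          x 0 ≠ y 0 ∧ ∀ i, Fin.tail x i = !(Fin.tail y i) := by
        rw [funext_iff, Fin.forall_fin_succ]
        refine and_congr ?_ (forall_congr' fun i => ?_)
        · change (x 0 ^^ y 0) = true ↔ _
          cases x 0 <;> cases y 0 <;> simp
        · change (x i.succ ^^ y i.succ) = true ↔ x i.succ = !(y i.succ)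
          cases x i.succ <;> cases y i.succ <;> simp
      have h2 : x + y = (fun _ => true) + Fin.cons false (fun _ => true) ↔
          x 0 ≠ y 0 ∧ Fin.tail x = Fin.tail y := by
        rw [funext_iff, Fin.forall_fin_succ, funext_iff (f := Fin.tail x)]
        refine and_congr ?_ (forall_congr' fun i => ?_)
        · change (x 0 ^^ y 0) = true ↔ _
          cases x 0 <;> cases y 0 <;> simp
        · change (x i.succ ^^ y i.succ) = false ↔ x i.succ = y i.succ
          cases x i.succ <;> cases y i.succ <;> simp
      have h3 : x + y ∈ gens ((suffixes (n + 1)).map (Fin.cons (α := fun _ => Bool) false)) ↔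
          x 0 = y 0 ∧ (augmentedCube (n + 1)).Adj (Fin.tail x) (Fin.tail y) := by
        rw [gens_map cons_false_add, ih]
        have h4 : (x + y) 0 = false ↔ x 0 = y 0 := by
          change (x 0 ^^ y 0) = false ↔ _
          cases x 0 <;> cases y 0 <;> simp
        rw [← h4]
        constructor
        · rintro ⟨w, hw, hxy⟩
          refine ⟨?_, ?_⟩
          · rw [← hxy]
            rfl
          · have : Fin.tail x + Fin.tail y = Fin.tail (x + y) := rfl
            rw [this, ← hxy, Fin.tail_cons]
            exact hw
        · rintro ⟨h5, h6⟩
          refine ⟨_, h6, ?_⟩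
          rw [← h5]
          exact Fin.cons_self_tail (x + y)
      have h4 : x + y ∈ gens (suffixes (n + 2)) ↔ x + y = (fun _ => true) ∨
          x + y = (fun _ => true) + Fin.cons false (fun _ => true) ∨
          x + y ∈ gens ((suffixes (n + 1)).map (Fin.cons (α := fun _ => Bool) false)) :=
        mem_gens_cons_cons
      rw [h4, h1, h2, h3]
      change (_ ∧ _ ∨ _ ∧ (_ ∨ _)) ↔ _
      tauto

theorem Conn.connected_induce {n : ℕ} {A : Set (Fin n → Bool)} (h : Conn (suffixes n) A) :
    ((augmentedCube n).induce A).Connected := by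
  have key : ∀ x (hx : x ∈ A) y (hy : y ∈ A),
      ((augmentedCube n).induce A).Reachable ⟨x, hx⟩ ⟨y, hy⟩ := by
    intro x hx y hy
    have hp := h.2 x hx y hy
    induction hp with
    | refl => exact SimpleGraph.Reachable.refl _
    | tail _ hs ih =>
      refine (ih hs.1).trans (SimpleGraph.Adj.reachable ?_)
      exact adj_iff.2 hs.2.2
  exact
    { preconnected := fun a b => key a a.2 b b.2
      nonempty := h.1.to_subtype }

end AugmentedCube

open AugmentedCube in
theorem theorem3p4 (n : ℕ) (hn : 3 ≤ n) :
    (augmentedCube n).pendantTreeConnectivity 3 = ((2 * n - 3 : ℕ) : ℕ∞) := by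
  have hI := indep_suffixes n
  have hlen := length_suffixes n
  apply le_antisymm
  · obtain ⟨d, e, m, hl⟩ : ∃ d e m, suffixes n = d :: e :: m := by
      rcases h : suffixes n with _ | ⟨d, _ | ⟨e, m⟩⟩
      · simp [h] at hlen
        omega
      · simp [h] at hlen
        omega
      · exact ⟨d, e, m, rfl⟩
    rw [hl] at hI hlen
    have hd := hI.head_ne_zero
    have he := hI.tail.head_ne_zero
    -- The extremal set is a triangle: two of the neighbors of `0` belong to `S`, and what remains
    -- lies in the connection set of `e :: m`, of size $2(n-1)-1$.
    have hS : ({0, d, d + e} : Finset (Fin n → Bool)).card = 3 := by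
      rw [Finset.card_eq_three]
      refine ⟨0, d, d + e, hd.symm, ?_, ?_, rfl⟩
      · intro h
        obtain rfl := (add_eq_zero_iff d e).1 h.symm
        exact hI.head_notMem (mem_sp_of_mem (by simp))
      · simpa using he
    have hS2 : 2 < ({0, d, d + e} : Finset (Fin n → Bool)).card := by omega
    refine iInf₂_le_of_le _ hS ((SimpleGraph.localPendantTreeConnectivity_le (x := 0)
      hS2 (by simp)).trans ?_)
    have hsub : (augmentedCube n).neighborSet 0 \
        (({0, d, d + e} : Finset (Fin n → Bool)) : Set _) ⊆ gens (e :: m) := by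
      rintro y ⟨hy, hyS⟩
      rw [SimpleGraph.mem_neighborSet, adj_iff, zero_add, hl, mem_gens_cons_cons] at hy
      simp only [Finset.coe_insert, Finset.coe_singleton, Set.mem_insert_iff,
        Set.mem_singleton_iff] at hyS
      rcases hy with hy | hy | hy
      · exact absurd (Or.inr (Or.inl hy)) hyS
      · exact absurd (Or.inr (Or.inr hy)) hyS
      · exact hy
    refine (Set.encard_le_encard hsub).trans ?_
    rw [← (gens_finite _).cast_ncard_eq, hI.tail.ncard_gens]
    simp only [List.length_cons] at hlen ⊢
    exact_mod_cast (by omega)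
  · refine le_iInf₂ fun S hS => ?_
    obtain ⟨x, y, z, hxy, hxz, hyz, rfl⟩ := Finset.card_eq_three.1 hS
    have hsp : ∀ t, t ∈ sp (suffixes n) := fun t => sp_suffixes n ▸ Submodule.mem_top
    have hP := hI.packs (by omega) (hsp (y + x)) (hsp (z + x)) hxy.symm hxz.symm hyz
    rw [hlen] at hP
    obtain ⟨C, hC, hd⟩ := hP
    refine SimpleGraph.le_localPendantTreeConnectivity C (fun i => (hC i).1.connected_induce)
      (fun i t ht hts => ((hC i).2.1 t ht).1 (by simpa using hts)) (fun i s hs => ?_) hd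
    obtain ⟨t, ht, hst⟩ := (hC i).2.2 s (by simpa using hs)
    exact ⟨t, ht, adj_iff.2 hst⟩
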